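/- Let $G$ be a finite graph, loops and multiple edges allowed, with vertex set $V$ and edge set $E$, and orient its edges arbitrarily. For an edge $e=(i\to j)$ let $v_e\in\mathbb Z^V$ have $i$-th coordinate $1$, $j$-th coordinate $-1$ and all other coordinates $0$ (and $v_e=0$ if $e$ is a loop). Let $V_G=\{\lambda:E\to\mathbb R \mid \sum_{e\in E}\lambda(e)v_e=0\}$ and $H_e=\{\lambda\in V_G\mid \lambda(e)=0\}$ for $e\in E$. Let $L_G^\perp$ be the set of all intersections $\bigcap_{e\in S}H_e$, $S\subseteq E$ (with $\bigcap_{e\in\emptyset}H_e=V_G$), ordered by reverse inclusion. The Möbius coinvariant of $G$ is $$\mu^\perp(G)=|\mu_{L_G^\perp}(\hat 0,\hat 1)|,$$ with the usual matroid convention that $\mu^\perp(G)=0$ if some $H_e$ is all of $V_G$, i.e. if $G$ has an isthmus $e$. For $m,n\ge 0$ the bipartite matching polynomial is $H_{m,n}(x,y)=\sum_M x^{a(M)}y^{b(M)}$, where $M$ runs over all partial matchings (sets of pairwise disjoint edges) of the complete bipartite graph $K_{m,n}$, and $a(M)$ and $b(M)$ are the numbers of vertices of the first and of the second part, respectively,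 that have degree $0$ in $M$. Put $H_{m,n}=0$ if $m<0$ or $n<0$. **Theorem.** For all integers $m,n\ge 1$, $$\mu^\perp(K_{m,n})=(m-1)(n-1)\,H_{m-2,\,n-2}(n-1,\,m-1).$$ More generally, for integers $m,n,k,l\ge 0$ let $K_{m,n}^{(k,l)}$ be the graph $K_{m,n}$ with one additional vertex that is joined by $k$ edges to each vertex of the first part and by $l$ edges to each vertex of the second part. If this graph is connected (that is: $k\ge1$, or both $n\ge 1$ and $l\ge 1$, whenever $m\ge 1$; and $l\ge 1$, or both $m\ge 1$ and $k\ge 1$, whenever $n\ge 1$), then $$\mu^\perp(K_{m,n}^{(k,l)})=H_{m,n}(n+k-1,\,m+l-1)-mn\,H_{m-1,\,n-1}(n+k-1,\,m+l-1).$$ -/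

import Mathlib

/-- A finite directed graph with vertex type `V` and edge type `E`; loops and multiple edges are
allowed. The edge `e` goes from `tail e` to `head e`. -/
structure DirectedMultigraph (V E : Type*) where
  tail : E → V
  head : E → V

namespace DirectedMultigraph

variable {V E : Type*}

/-- `G` is an orientation of the undirected multigraph whose edge `e` has the unordered pair of
end points `ends e`. -/
def IsOrientationOf (G : DirectedMultigraph V E) (ends : E → Sym2 V) : Prop :=
  ∀ e, s(G.tail e, G.head e) = ends e

/-- The vector `v_e` of an edge `e = (i → j)`: coordinate `1` at `i`, `-1` at `j`, and `0`
elsewhere; it is the zero vector when `e` is a loop. -/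
def edgeVector [DecidableEq V] (G : DirectedMultigraph V E) (e : E) : V → ℝ :=
  Pi.single (G.tail e) 1 - Pi.single (G.head e) 1

/-- The space `V_G` of all `w : E → ℝ` such that `∑ e, w e • v_e = 0`. -/
def flowSpace [DecidableEq V] [Fintype E] (G : DirectedMultigraph V E) : Submodule ℝ (E → ℝ) :=
  LinearMap.ker (Fintype.linearCombination ℝ G.edgeVector)

theorem mem_flowSpace [DecidableEq V] [Fintype E] (G : DirectedMultigraph V E) (w : E → ℝ) :
    w ∈ G.flowSpace ↔ ∑ e, w e • G.edgeVector e = 0 := by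
  simp [flowSpace, Fintype.linearCombination_apply]

/-- The member `H_e = {w ∈ V_G | w e = 0}` of the cographic arrangement. It is all of `V_G` exactly
when `e` is an isthmus. -/
def cographicHyperplane [DecidableEq V] [Fintype E] (G : DirectedMultigraph V E) (e : E) :
    Submodule ℝ G.flowSpace :=
  LinearMap.ker ((LinearMap.proj e : (E → ℝ) →ₗ[ℝ] ℝ) ∘ₗ G.flowSpace.subtype)

theorem mem_cographicHyperplane [DecidableEq V] [Fintype E] (G : DirectedMultigraph V E) (e : E)
    (w : G.flowSpace) : w ∈ G.cographicHyperplane e ↔ (w : E → ℝ) e = 0 := by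
  simp [cographicHyperplane]

/-- The intersection lattice of the cographic arrangement: all subspaces `⋂ e ∈ S, H_e` with
`S ⊆ E` (the empty intersection being `V_G`), ordered by reverse inclusion. -/
abbrev CographicLattice [DecidableEq V] [Fintype E] (G : DirectedMultigraph V E) : Type _ :=
  {W : Submodule ℝ G.flowSpace // ∃ S : Finset E, W = ⨅ e ∈ S, G.cographicHyperplane e}ᵒᵈ

/-- The least element is `V_G`, the greatest one is the intersection of all `H_e`. -/
instance [DecidableEq V] [Fintype E] (G : DirectedMultigraph V E) :
    BoundedOrder G.CographicLattice where
  bot := OrderDual.toDual ⟨⊤, ∅, by simp⟩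
  top := OrderDual.toDual ⟨⨅ e ∈ Finset.univ, G.cographicHyperplane e, Finset.univ, rfl⟩
  bot_le W := OrderDual.toDual_le.2 (Subtype.coe_le_coe.1 le_top)
  le_top W := by
    obtain ⟨S, hS⟩ := (OrderDual.ofDual W).2
    refine OrderDual.le_toDual.2 (Subtype.coe_le_coe.1 ?_)
    rw [hS]
    exact biInf_mono fun e _ => Finset.mem_univ e

instance [DecidableEq V] [Fintype E] (G : DirectedMultigraph V E) : Finite G.CographicLattice :=
  Finite.of_surjective
    (fun S : Finset E => (OrderDual.toDual ⟨⨅ e ∈ S, G.cographicHyperplane e, S, rfl⟩ :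
      G.CographicLattice))
    (fun W => by
      obtain ⟨S, hS⟩ := (OrderDual.ofDual W).2
      exact ⟨S, congrArg OrderDual.toDual (Subtype.ext hS.symm)⟩)

open Classical in
/-- The value `μ(0̂, 1̂)` of the Möbius function of the intersection lattice of the cographic
arrangement. -/
noncomputable def cographicMobius [DecidableEq V] [Fintype E] (G : DirectedMultigraph V E) : ℤ :=
  letI : Fintype G.CographicLattice := Fintype.ofFinite _
  letI : LocallyFiniteOrder G.CographicLattice := Fintype.toLocallyFiniteOrder
  IncidenceAlgebra.mu ℤ (⊥ : G.CographicLattice) ⊤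

open Classical in
/-- The Möbius coinvariant: `|μ(0̂, 1̂)|` for the intersection lattice of the cographic arrangement,
with the usual matroid convention that it is `0` if the arrangement is degenerate, i.e. if some
`H_e` is the whole space (some edge is an isthmus). -/
noncomputable def mobiusCoinvariant [DecidableEq V] [Fintype E] (G : DirectedMultigraph V E) : ℕ :=
  if ∃ e, G.cographicHyperplane e = ⊤ then 0 else G.cographicMobius.natAbs

end DirectedMultigraph

/-- The edges of the complete bipartite graph `K_{m,n}`, indexed by `Fin m × Fin n`. -/
def completeBipartiteEnds (m n : ℕ) : Fin m × Fin n → Sym2 (Fin m ⊕ Fin n) :=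
  fun e => s(Sum.inl e.1, Sum.inr e.2)

/-- The edges of `K_{m,n}^{(k,l)}`: the graph `K_{m,n}` with an additional vertex `none` that is
joined by `k` edges to each vertex of the first part and by `l` edges to each vertex of the second
part. -/
def rootedBipartiteEnds (m n k l : ℕ) :
    (Fin m × Fin n) ⊕ (Fin m × Fin k) ⊕ (Fin n × Fin l) → Sym2 (Option (Fin m ⊕ Fin n))
  | Sum.inl e => s(some (Sum.inl e.1), some (Sum.inr e.2))
  | Sum.inr (Sum.inl e) => s(none, some (Sum.inl e.1))
  | Sum.inr (Sum.inr e) => s(none, some (Sum.inr e.1))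

/-- A set of edges of `K_{m,n}` is a partial matching if its edges are pairwise disjoint. -/
def IsPartialMatching {m n : ℕ} (M : Finset (Fin m × Fin n)) : Prop :=
  ∀ e ∈ M, ∀ f ∈ M, e ≠ f → e.1 ≠ f.1 ∧ e.2 ≠ f.2

open Classical in
/-- The sum of `x ^ a(M) * y ^ b(M)` over all partial matchings `M` of `K_{m,n}`, where `a(M)` and
`b(M)` are the numbers of vertices of the first and of the second part that `M` does not cover. -/
noncomputable def matchingSum {R : Type*} [CommRing R] (m n : ℕ) (x y : R) : R :=
  ∑ M : Finset (Fin m × Fin n) with IsPartialMatching M,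
    x ^ (Finset.univ.filter fun i : Fin m => ∀ e ∈ M, e.1 ≠ i).card *
      y ^ (Finset.univ.filter fun j : Fin n => ∀ e ∈ M, e.2 ≠ j).card

/-- The bipartite matching polynomial `H_{m,n}(x, y)`, with `H_{m,n} = 0` if an index is
negative. -/
noncomputable def bipartiteHermite {R : Type*} [CommRing R] (m n : ℤ) (x y : R) : R :=
  if 0 ≤ m ∧ 0 ≤ n then matchingSum m.toNat n.toNat x y else 0

/-! A crosscut argument turns $\mu(\hat 0,\hat 1)$ of the cographic lattice into a signed count of
the sets $S$ of edges whose hyperplanes meet in the smallest subspace. These are the complements of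
the forests, so $\mu^\perp(G)=|\sum_F(-1)^{|F|}|$ over the forests $F$
(`mobiusCoinvariant_eq_natAbs`). By deletion and contraction the sum has sign $(-1)^{\mathrm{rank}}$
(`signedIndepSum_sign`).

To evaluate the sum, fix a root and let every other vertex choose an incident edge or, with sign
$-1$, nothing. The choices whose set of chosen edges is a given forest $F$ have total sign
$(-1)^{|U|+|F|}$, where $U$ is the set of non-root vertices. Forests are then detected by
determinants: the matrix with rows $e_v-e_w$, where $w$ is the vertex to which the choice of $v$
leads (no $e_w$ if there is no such non-root vertex), has determinant $1$ if following the choices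
never runs into a cycle, and $0$ otherwise. The only cycles that a forest allows are 2-cycles, from
edges chosen by both end points. Replacing the rows at the ends of such edges by unit rows breaks
them; if one is left unbroken, the determinant vanishes. Hence summing over all sets $M$ of such
edges gives the indicator of forests. For fixed $M$, which must be a matching, multilinearity
collects all choices into one determinant: the reduced Laplacian minus the identity, with unit rows
at the vertices covered by $M$ (`signedIndepSum_vec_eq_sum_det`).

For $K_{m,n}^{(k,l)}$ put $x=n+k-1$, $y=m+l-1$. With $p$ and $q$ uncovered vertices in the two
parts, the determinant is $x^py^q-pq\,x^{p-1}y^{q-1}$. Summed over $M$, the first term gives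
$H_{m,n}$; the second gives $mn\,H_{m-1,n-1}$, since it marks an uncovered vertex in each part.
Finally, $K_{m+1,n}$ is $K_{m,n}^{(0,1)}$, and recurrences for $H$ simplify the result. -/

open Finset

/-! ### Crosscut formula for the Möbius function -/

section Crosscut

variable {α E : Type*} [PartialOrder α] [BoundedOrder α] [LocallyFiniteOrder α] [DecidableEq α]
  [Fintype E]

/-- A crosscut formula: if `J S` is the join of the elements `a e`, `e ∈ S`, every element is such
a join and no `a e` is the least element, then the Möbius function is a signed count of the sets
with a given join. -/
theorem mu_bot_eq_sum_of_join [Finite α] (J : Finset E → α) (a : E → α)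
    (hJ : ∀ S x, J S ≤ x ↔ ∀ e ∈ S, a e ≤ x) (hsurj : ∀ x, ∃ S, J S = x) (ha : ∀ e, a e ≠ ⊥)
    (x : α) : IncidenceAlgebra.mu ℤ (⊥ : α) x = ∑ S : Finset E with J S = x, (-1) ^ S.card := by
  classical
  -- Summed over all $y\le x$, the count runs over all subsets of $\{e\mid a_e\le x\}$, so it
  -- vanishes unless this set is empty, that is, unless $x=\bot$. This is the recursion that
  -- determines $\mu$.
  have hsum : ∀ x : α, ∑ y ∈ Icc ⊥ x, ∑ S : Finset E with J S = y, (-1 : ℤ) ^ S.card =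
      if ⊥ = x then 1 else 0 := by
    intro x
    have h1 : ∑ y ∈ Icc ⊥ x, ∑ S : Finset E with J S = y, (-1 : ℤ) ^ S.card =
        ∑ S ∈ (univ.filter fun e => a e ≤ x).powerset, (-1 : ℤ) ^ S.card := by
      rw [← Finset.sum_fiberwise_of_maps_to (t := Icc ⊥ x) (g := J)]
      · refine sum_congr rfl fun y hy => sum_congr ?_ fun _ _ => rfl
        ext S
        simp only [mem_filter, mem_univ, true_and, mem_powerset]
        refine ⟨fun h => ⟨fun e he => ?_, h⟩, fun h => h.2⟩
        simp only [mem_filter, mem_univ, true_and]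
        exact (hJ S x).1 (h ▸ (mem_Icc.1 hy).2) e he
      · intro S hS
        refine mem_Icc.2 ⟨bot_le, (hJ S x).2 fun e he => ?_⟩
        simpa using mem_powerset.1 hS he
    rw [h1, sum_powerset_neg_one_pow_card]
    refine if_congr ?_ rfl rfl
    rw [filter_eq_empty_iff]
    constructor
    · intro h
      obtain ⟨S, rfl⟩ := hsurj x
      have : S = ∅ := eq_empty_of_forall_notMem fun e he => h (mem_univ e) ((hJ S _).1 le_rfl e he)
      subst this
      exact (le_bot_iff.1 ((hJ ∅ ⊥).2 (by simp))).symm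
    · rintro rfl e - h
      exact ha e (le_bot_iff.1 h)
  induction x using WellFoundedLT.induction with
  | _ x ih =>
    have h1 := IncidenceAlgebra.sum_Icc_mu_right (𝕜 := ℤ) ⊥ x
    have h2 := hsum x
    rw [← Ico_insert_right (bot_le : ⊥ ≤ x), sum_insert (by simp)] at h1 h2
    rw [sum_congr rfl fun y hy => ih y (mem_Ico.1 hy).2] at h1
    linarith

end Crosscut

/-! ### Signed count of independent subfamilies -/

section SignedIndepSum

open Classical in
/-- The signed count of the independent subfamilies of a finite family of vectors. -/
noncomputable def signedIndepSum {E W : Type*} [Fintype E] [AddCommGroup W] [Module ℝ W]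
    (v : E → W) : ℤ :=
  ∑ F ∈ univ.filter (fun F : Finset E => LinearIndepOn ℝ v (F : Set E)), (-1) ^ F.card

variable {E E' W W' : Type*} [Fintype E] [Fintype E'] [AddCommGroup W] [Module ℝ W]
  [AddCommGroup W'] [Module ℝ W']

/-- Injective linear maps and sign changes of single vectors preserve independence. This makes the
count free of the orientation and of the choice of coordinates. -/
theorem signedIndepSum_eq_of_equiv (σ : E ≃ E') (ι : W →ₗ[ℝ] W')
    (hι : Function.Injective ι) (v : E → W) (v' : E' → W')
    (h : ∀ e, v' (σ e) = ι (v e) ∨ v' (σ e) = -ι (v e)) :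
    signedIndepSum v' = signedIndepSum v := by
  classical
  have hs : ∀ e, ∃ s : ℝ, s ≠ 0 ∧ v' (σ e) = s • ι (v e) := fun e => by
    rcases h e with h | h
    · exact ⟨1, by simp, by simpa using h⟩
    · exact ⟨-1, by simp, by simpa using h⟩
  choose s hs0 hs using hs
  unfold signedIndepSum
  symm
  refine sum_equiv σ.finsetCongr (fun F => ?_) fun F _ => by simp
  simp only [mem_filter, mem_univ, true_and, Equiv.finsetCongr_apply, linearIndepOn_finset_iff,
    sum_map, mem_map_equiv, Equiv.coe_toEmbedding]
  have key : ∀ c : E → ℝ, ∑ e ∈ F, c e • v' (σ e) = ι (∑ e ∈ F, (c e * s e) • v e) := fun c => by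
    simp [hs, mul_smul]
  constructor
  · intro H c hc e he
    rw [key fun e => c (σ e)] at hc
    have := H _ (hι (hc.trans ι.map_zero.symm)) _ he
    simpa [hs0] using this
  · intro H c hc e he
    have := H (fun e => c (σ.symm e) * (s (σ.symm e))⁻¹) ?_ (σ e) (by simpa using he)
    · simpa [hs0] using this
    · rw [key fun e => c (σ.symm (σ e)) * (s (σ.symm (σ e)))⁻¹]
      simp only [Equiv.symm_apply_apply, inv_mul_cancel_right₀ (hs0 _)]
      rw [hc, map_zero]

end SignedIndepSum

/-! ### The Möbius coinvariant as a signed count of forests -/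

namespace DirectedMultigraph

variable {V E : Type*} [DecidableEq V] [Fintype E] (G : DirectedMultigraph V E)

theorem mem_biInf_cographicHyperplane (S : Finset E) (w : G.flowSpace) :
    w ∈ ⨅ e ∈ S, G.cographicHyperplane e ↔ ∀ e ∈ S, (w : E → ℝ) e = 0 := by
  simp [Submodule.mem_iInf, mem_cographicHyperplane]

/-- A flow vanishing on `S` is the same as a linear relation among the edge vectors outside `S`. -/
theorem biInf_cographicHyperplane_eq_univ_iff [DecidableEq E] (S : Finset E) :
    (⨅ e ∈ S, G.cographicHyperplane e) = ⨅ e ∈ (univ : Finset E), G.cographicHyperplane e ↔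
      LinearIndepOn ℝ G.edgeVector ((Sᶜ : Finset E) : Set E) := by
  rw [linearIndepOn_finset_iff]
  constructor
  · intro h c hc e he
    let w : E → ℝ := fun e => if e ∈ S then 0 else c e
    have hw : w ∈ G.flowSpace := by
      rw [mem_flowSpace, ← hc, ← sum_subset (subset_univ Sᶜ)]
      · refine sum_congr rfl fun e he => ?_
        simp [w, mem_compl.1 he]
      · intro e _ he
        simp [w, not_not.1 (mt mem_compl.2 he)]
    have h1 : (⟨w, hw⟩ : G.flowSpace) ∈ ⨅ e ∈ S, G.cographicHyperplane e := by
      rw [mem_biInf_cographicHyperplane]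
      intro e he
      simp [w, he]
    rw [h, mem_biInf_cographicHyperplane] at h1
    simpa [w, mem_compl.1 he] using h1 e (mem_univ e)
  · intro h
    ext w
    rw [mem_biInf_cographicHyperplane, mem_biInf_cographicHyperplane]
    refine ⟨fun hS => ?_, fun hS e _ => hS e (mem_univ e)⟩
    have hw := (G.mem_flowSpace w).1 w.2
    rw [← sum_subset (subset_univ Sᶜ)] at hw
    · intro e _
      by_cases he : e ∈ S
      · exact hS e he
      · exact h _ hw e (mem_compl.2 he)
    · intro e _ he
      simp [hS e (not_not.1 (mt mem_compl.2 he))]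

open Classical in
theorem sum_biInf_cographicHyperplane_eq :
    ∑ S : Finset E with (⨅ e ∈ S, G.cographicHyperplane e) =
        ⨅ e ∈ (univ : Finset E), G.cographicHyperplane e, (-1 : ℤ) ^ S.card =
      (-1) ^ Fintype.card E * signedIndepSum G.edgeVector := by
  rw [signedIndepSum, mul_sum]
  refine sum_nbij' compl compl ?_ ?_ ?_ ?_ ?_
  · intro S hS
    exact mem_filter.2 ⟨mem_univ _, (G.biInf_cographicHyperplane_eq_univ_iff S).1 (mem_filter.1 hS).2⟩
  · intro S hS
    refine mem_filter.2 ⟨mem_univ _, (G.biInf_cographicHyperplane_eq_univ_iff Sᶜ).2 ?_⟩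
    rw [compl_compl]
    exact (mem_filter.1 hS).2
  · exact fun S _ => compl_compl S
  · exact fun S _ => compl_compl S
  · intro S _
    rw [card_compl, ← pow_add]
    have := S.card_le_univ
    rw [neg_one_pow_congr]
    grind

/-- The Möbius coinvariant is the absolute value of the signed count of the forests. -/
theorem mobiusCoinvariant_eq_natAbs :
    G.mobiusCoinvariant = (signedIndepSum G.edgeVector).natAbs := by
  classical
  have key : (signedIndepSum G.edgeVector).natAbs =
      (∑ S : Finset E with (⨅ e ∈ S, G.cographicHyperplane e) =
        ⨅ e ∈ (univ : Finset E), G.cographicHyperplane e, (-1 : ℤ) ^ S.card).natAbs := by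
    rw [sum_biInf_cographicHyperplane_eq, Int.natAbs_mul, Int.natAbs_pow]
    simp
  rw [mobiusCoinvariant, key]
  split_ifs with h
  · obtain ⟨e, he⟩ := h
    symm
    rw [Int.natAbs_eq_zero]
    -- All flows vanish on an isthmus `e`, so adding or removing `e` keeps the intersection and
    -- flips the sign: the convention $0$ agrees with the forest count.
    refine sum_involution (fun S _ => symmDiff S {e}) ?_ ?_ ?_ ?_
    · intro S _
      by_cases hS : e ∈ S
      · rw [symmDiff_of_ge (by simpa using hS), ← card_sdiff_add_card_eq_card
          (singleton_subset_iff.2 hS)]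
        simp [pow_succ]
      · rw [symmDiff_eq_union_iff .. |>.2 (by simpa using hS),
          card_union_of_disjoint (by simpa using hS)]
        simp [pow_succ]
    · intro S _ _ hS
      have := congrArg (fun T => symmDiff S T) hS
      simp at this
    · intro S hS
      simp only [mem_filter, mem_univ, true_and] at hS ⊢
      rw [← hS]
      ext w
      rw [mem_biInf_cographicHyperplane, mem_biInf_cographicHyperplane]
      have hwe : (w : E → ℝ) e = 0 := by
        rw [← mem_cographicHyperplane, he]; trivial
      refine forall_congr' fun f => ?_
      by_cases hf : f = e
      · subst hf; simp [hwe]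
      · simp [mem_symmDiff, hf]
    · intro S _
      simp
  · push Not at h
    congr 1
    unfold cographicMobius
    let _ : Fintype G.CographicLattice := Fintype.ofFinite _
    let _ : LocallyFiniteOrder G.CographicLattice := Fintype.toLocallyFiniteOrder
    have := mu_bot_eq_sum_of_join (α := G.CographicLattice)
      (fun S : Finset E => OrderDual.toDual ⟨⨅ e ∈ S, G.cographicHyperplane e, S, rfl⟩)
      (fun e => OrderDual.toDual ⟨⨅ f ∈ ({e} : Finset E), G.cographicHyperplane f, {e}, rfl⟩)
      ?_ ?_ ?_ ⊤
    · refine Eq.trans ?_ (this.trans ?_)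
      · rfl
      · refine sum_congr ?_ fun _ _ => rfl
        ext S
        rw [mem_filter, mem_filter]
        exact and_congr_right fun _ => OrderDual.toDual_inj.trans Subtype.ext_iff
    · intro S x
      obtain ⟨W, hW⟩ := x
      change W ≤ ⨅ e ∈ S, G.cographicHyperplane e ↔
        ∀ e ∈ S, W ≤ ⨅ f ∈ ({e} : Finset E), G.cographicHyperplane f
      simp
    · rintro ⟨W, S, rfl⟩
      exact ⟨S, rfl⟩
    · intro e he
      have := congrArg Subtype.val (OrderDual.toDual_inj.1 he)
      simp only [mem_singleton, iInf_iInf_eq_left] at this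
      exact h e this

end DirectedMultigraph

/-! ### The sign of the count -/

section Sign

open Classical in
-- Deletion and contraction: the sets containing `e` correspond to independent sets in the quotient
-- by `v e`, where the drop in rank compensates the extra sign. The quotient is why `W` must vary in
-- the induction.
theorem sum_powerset_indep_nonneg {E : Type*} (T : Finset E) :
    ∀ {W : Type*} [AddCommGroup W] [Module ℝ W] [FiniteDimensional ℝ W] (v : E → W),
      Submodule.span ℝ (v '' T) = ⊤ →
      0 ≤ (-1 : ℤ) ^ Module.finrank ℝ W *
        ∑ F ∈ T.powerset.filter (fun F : Finset E => LinearIndepOn ℝ v (F : Set E)), (-1) ^ F.card := by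
  induction T using Finset.induction_on with
  | empty =>
    intro W _ _ _ v hv
    have : Module.finrank ℝ W = 0 := by
      rw [← finrank_top, ← hv]; simp
    simp [this, filter_singleton]
  | insert e T he ih =>
    intro W _ _ _ v hv
    rw [coe_insert, Set.image_insert_eq] at hv
    rw [sum_filter, sum_powerset_insert he, ← sum_filter, ← sum_filter]
    have hcard : ∀ F ∈ T.powerset, (insert e F).card = F.card + 1 := fun F hF =>
      card_insert_of_notMem fun h => he (mem_powerset.1 hF h)
    by_cases h0 : v e = 0
    · rw [h0, Submodule.span_insert_zero] at hv
      rw [filter_false_of_mem (s := T.powerset)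
        (p := fun F : Finset E => LinearIndepOn ℝ v ((insert e F : Finset E) : Set E)), sum_empty, add_zero]
      · exact ih v hv
      · intro F _ hF
        exact hF.ne_zero (i := e) (by simp) h0
    · obtain ⟨p, hp⟩ : ∃ p, p = Submodule.span ℝ (v '' {e}) := ⟨_, rfl⟩
      have hind : ∀ F ∈ T.powerset, (LinearIndepOn ℝ v ((insert e F : Finset E) : Set E) ↔
          LinearIndepOn ℝ (p.mkQ ∘ v) (F : Set E)) := by
        intro F hF
        have h1 : LinearIndepOn ℝ v {e} := by simpa using h0
        rw [hp, h1.quotient_iff_union, coe_insert, Set.insert_eq]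
        exact Set.disjoint_singleton_left.2 fun h => he (mem_powerset.1 hF h)
      have hneg : ∑ F ∈ T.powerset.filter
          (fun F : Finset E => LinearIndepOn ℝ v ((insert e F : Finset E) : Set E)),
          (-1 : ℤ) ^ (insert e F).card = ∑ F ∈ T.powerset.filter
          (fun F : Finset E => LinearIndepOn ℝ (p.mkQ ∘ v) (F : Set E)), -(-1) ^ F.card := by
        rw [filter_congr hind]
        refine sum_congr rfl fun F hF => ?_
        rw [hcard F (mem_filter.1 hF).1]; ring
      rw [hneg]
      have hrank : Module.finrank ℝ W = Module.finrank ℝ (W ⧸ p) + 1 := by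
        rw [← p.finrank_quotient_add_finrank]
        rw [hp, Set.image_singleton, finrank_span_singleton h0]
      have hq : Submodule.span ℝ ((p.mkQ ∘ v) '' T) = ⊤ := by
        have h2 := congrArg (Submodule.map p.mkQ) hv
        rw [Submodule.map_top, p.range_mkQ, Submodule.map_span, Set.image_insert_eq] at h2
        have h3 : p.mkQ (v e) = 0 := by
          rw [Submodule.mkQ_apply, Submodule.Quotient.mk_eq_zero]
          exact hp ▸ Submodule.subset_span ⟨e, rfl, rfl⟩
        rw [h3, Submodule.span_insert_zero] at h2
        rwa [Set.image_comp]
      have hQ := ih (p.mkQ ∘ v) hq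
      by_cases hT : Submodule.span ℝ (v '' T) = ⊤
      · have := ih v hT
        rw [sum_neg_distrib, mul_add]
        rw [hrank, pow_succ] at *
        linarith
      -- Now `e` is a coloop: `F` and `insert e F` are independent together, and their signs cancel.
      · have hnot : v e ∉ Submodule.span ℝ (v '' T) := fun h => hT (by
          rw [← hv, Submodule.span_insert_eq_span h])
        rw [filter_congr (q := fun F : Finset E => LinearIndepOn ℝ (p.mkQ ∘ v) (F : Set E))]
        · rw [← sum_add_distrib]
          simp
        · intro F hF
          rw [← hind F hF, coe_insert, linearIndepOn_insert]
          · refine ⟨fun h => ⟨h, fun h' => hnot ?_⟩, fun h => h.1⟩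
            exact Submodule.span_mono (Set.image_mono (by simpa using hF)) h'
          · exact fun h => he (mem_powerset.1 hF h)

theorem signedIndepSum_sign {E W : Type*} [Fintype E] [AddCommGroup W] [Module ℝ W]
    [FiniteDimensional ℝ W] (v : E → W) (hv : Submodule.span ℝ (Set.range v) = ⊤) :
    ((signedIndepSum v).natAbs : ℤ) = (-1) ^ Module.finrank ℝ W * signedIndepSum v := by
  classical
  have h := sum_powerset_indep_nonneg (univ : Finset E) v (by simpa using hv)
  have h' : 0 ≤ (-1) ^ Module.finrank ℝ W * signedIndepSum v := by
    convert h using 2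
    simp only [signedIndepSum, powerset_univ]
  rw [Int.natCast_natAbs, ← abs_of_nonneg h', abs_mul, abs_pow]
  simp

end Sign

/-! ### Graphs with a root and their reduced edge vectors -/

/-- A loopless multigraph with a root vertex. The non-root vertices are the elements of `U`, and the
root is represented by `none`. No edge starts at the root. -/
structure RootedGraph (U E : Type*) where
  tail : E → U
  head : E → Option U
  head_ne : ∀ e, head e ≠ some (tail e)

namespace RootedGraph

variable {U E : Type*} [DecidableEq U] (G : RootedGraph U E)

/-- The edge vector of `e` with the coordinate of the root removed. -/
def vec (e : E) : U → ℝ :=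
  Pi.single (G.tail e) 1 - (G.head e).elim 0 fun u => Pi.single u 1

/-- The non-root vertex `v` is an end point of `e`. -/
abbrev Inc (v : U) (e : E) : Prop := G.tail e = v ∨ G.head e = some v

/-- The end point of `e` different from `v`. -/
def other (v : U) (e : E) : Option U := if G.tail e = v then G.head e else some (G.tail e)

theorem vec_apply_eq_zero {v : U} {e : E} (h : ¬ G.Inc v e) : G.vec e v = 0 := by
  rw [not_or] at h
  rcases hh : G.head e with _ | u
  · simp [vec, hh, Ne.symm h.1]
  · have : v ≠ u := fun hu => h.2 (by rw [hh, hu])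
    simp [vec, hh, Ne.symm h.1, this]

/-- The coordinate of the edge vector at an end point `v` is $\pm1$; multiplying by it directs the
edge away from `v`. -/
theorem vec_smul_vec {v : U} {e : E} (h : G.Inc v e) :
    G.vec e v • G.vec e = Pi.single v 1 - (G.other v e).elim 0 fun u => Pi.single u 1 := by
  have hne := G.head_ne e
  by_cases ht : G.tail e = v
  · subst ht
    rcases hh : G.head e with _ | u
    · simp [vec, other, hh]
    · have : G.tail e ≠ u := fun hu => hne (by rw [hh, hu])
      simp [vec, other, hh, this]
  · have hh : G.head e = some v := h.resolve_left ht
    simp [vec, other, hh, ht, Ne.symm ht]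

theorem vec_apply_ne_zero {v : U} {e : E} (h : G.Inc v e) : G.vec e v ≠ 0 := by
  intro h0
  have h1 := congrFun (G.vec_smul_vec h) v
  have hne := G.head_ne e
  rw [h0, zero_smul] at h1
  by_cases ht : G.tail e = v
  · subst ht
    rcases hh : G.head e with _ | u
    · simp [other, hh] at h1
    · have : G.tail e ≠ u := fun hu => hne (by rw [hh, hu])
      simp [other, hh, this] at h1
  · simp [other, ht, Ne.symm ht] at h1

theorem sum_vec [Fintype U] {e : E} (h : G.head e ≠ none) : ∑ v, G.vec e v = 0 := by
  obtain ⟨u, hu⟩ := Option.ne_none_iff_exists'.1 h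
  simp [vec, hu, Pi.single_apply]

/-! ### Leaves of forests and an alternating degree sum -/

section Leaf

variable [Fintype U]

/-- If the coordinates in `Y` detect the vanishing of every combination, restriction to `Y` keeps
the family independent, now in dimension $|Y|$. -/
theorem card_le_of_linearIndepOn {F : Finset E} (hF : LinearIndepOn ℝ G.vec (F : Set E))
    (Y : Finset U) (h : ∀ c : E → ℝ, (∀ v ∈ Y, (∑ e ∈ F, c e • G.vec e) v = 0) →
      ∑ e ∈ F, c e • G.vec e = 0) : F.card ≤ Y.card := by
  have : LinearIndepOn ℝ (fun e (y : Y) => G.vec e y) (F : Set E) := by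
    rw [linearIndepOn_finset_iff] at hF ⊢
    intro c hc
    refine hF c (h c fun v hv => ?_)
    simpa using congrFun hc ⟨v, hv⟩
  have h1 := this.linearIndependent.fintype_card_le_finrank
  simpa using h1

/-- Handshake argument: with all degrees at least $2$, $2|X|\le\sum\deg\le2|F|\le2|X|$. Equality
excludes edges to the root, but then all vectors have coordinate sum $0$ and $|F|\le|X|-1$. -/
theorem exists_degree_le_one {X : Finset U} (hX : X.Nonempty) {F : Finset E}
    (hFX : ∀ e ∈ F, ∀ v, G.Inc v e → v ∈ X) (hF : LinearIndepOn ℝ G.vec (F : Set E)) :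
    ∃ v ∈ X, (F.filter (G.Inc v)).card ≤ 1 := by
  by_contra! hdeg
  have hzero : ∀ c : E → ℝ, ∀ v ∉ X, (∑ e ∈ F, c e • G.vec e) v = 0 := fun c v hv => by
    rw [Finset.sum_apply]
    refine sum_eq_zero fun e he => ?_
    rw [Pi.smul_apply, G.vec_apply_eq_zero fun h => hv (hFX e he v h), smul_zero]
  have hle : F.card ≤ X.card := by
    refine G.card_le_of_linearIndepOn hF X fun c hc => ?_
    ext v
    by_cases hv : v ∈ X
    · exact hc v hv
    · exact hzero c v hv
  have h1 : X.card * 2 ≤ ∑ v ∈ X, (F.filter (G.Inc v)).card := by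
    rw [← smul_eq_mul]
    exact card_nsmul_le_sum X (fun v => (F.filter (G.Inc v)).card) 2 fun v hv => hdeg v hv
  have h2 : ∑ v ∈ X, (F.filter (G.Inc v)).card = ∑ e ∈ F, (X.filter fun v => G.Inc v e).card := by
    simp only [card_filter]
    exact sum_comm
  have hends : ∀ e, (X.filter fun v => G.Inc v e) ⊆ insert (G.tail e) (G.head e).toFinset := by
    intro e v hv
    rcases (mem_filter.1 hv).2 with h | h
    · simp [h]
    · simp [h]
  have hends2 : ∀ e ∈ F, (X.filter fun v => G.Inc v e).card ≤ 2 := fun e _ => by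
    refine (card_le_card (hends e)).trans ((card_insert_le _ _).trans ?_)
    rw [Option.card_toFinset]
    rcases G.head e with _ | u <;> simp
  have hroot : ∀ e ∈ F, G.head e ≠ none := by
    intro e he hn
    have h3 : ∑ e ∈ F, (X.filter fun v => G.Inc v e).card < ∑ e ∈ F, 2 := by
      refine sum_lt_sum hends2 ⟨e, he, ?_⟩
      refine (card_le_card (hends e)).trans_lt ?_
      simp [hn]
    rw [sum_const, smul_eq_mul] at h3
    omega
  obtain ⟨x, hx⟩ := hX
  have hlt : F.card ≤ (X.erase x).card := by
    refine G.card_le_of_linearIndepOn hF _ fun c hc => ?_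
    have hne : ∀ v, v ≠ x → (∑ e ∈ F, c e • G.vec e) v = 0 := fun v hv => by
      by_cases hvX : v ∈ X
      · exact hc v (mem_erase.2 ⟨hv, hvX⟩)
      · exact hzero c v hvX
    have hsum : ∑ v, (∑ e ∈ F, c e • G.vec e) v = 0 := by
      simp only [Finset.sum_apply, Pi.smul_apply]
      rw [sum_comm]
      refine sum_eq_zero fun e he => ?_
      rw [← smul_sum, G.sum_vec (hroot e he), smul_zero]
    ext v
    by_cases hv : v = x
    · subst hv
      rwa [sum_eq_single v (fun u _ hu => hne u hu) (by simp)] at hsum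
    · exact hne v hv
  rw [card_erase_of_mem hx] at hlt
  have : 0 < X.card := card_pos.2 ⟨x, hx⟩
  have h3 := sum_le_sum hends2
  rw [sum_const, smul_eq_mul] at h3
  omega

variable [DecidableEq E]

/-- A leaf of a forest contributes a vanishing factor to every summand that uses its edge. -/
theorem sum_powerset_prod_degree_sub_one (n : ℕ) : ∀ (X : Finset U), X.card = n → ∀ F : Finset E,
    (∀ e ∈ F, ∀ v, G.Inc v e → v ∈ X) → LinearIndepOn ℝ G.vec (F : Set E) →
    ∑ F' ∈ F.powerset, (-1 : ℝ) ^ (F \ F').card *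
      ∏ v ∈ X, (((F'.filter (G.Inc v)).card : ℝ) - 1) = (-1) ^ (X.card + F.card) := by
  induction n with
  | zero =>
    intro X hX F hFX _
    rw [card_eq_zero] at hX
    subst hX
    have : F = ∅ := eq_empty_of_forall_notMem fun e he => by
      simpa using hFX e he (G.tail e) (Or.inl rfl)
    subst this
    simp
  | succ n ih =>
    intro X hX F hFX hF
    obtain ⟨v, hv, hdeg⟩ := G.exists_degree_le_one (card_pos.1 (by omega)) hFX hF
    have hXv : (X.erase v).card = n := by rw [card_erase_of_mem hv]; omega
    rcases Nat.le_one_iff_eq_zero_or_eq_one.1 hdeg with h0 | h1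
    · rw [card_eq_zero, filter_eq_empty_iff] at h0
      have := ih (X.erase v) hXv F (fun e he u hu => mem_erase.2
        ⟨fun huv => h0 he (huv ▸ hu), hFX e he u hu⟩) hF
      rw [hX, show n + 1 + F.card = (n + F.card) + 1 by ring, pow_succ, ← hXv, ← this, sum_mul]
      refine sum_congr rfl fun F' hF' => ?_
      rw [← mul_prod_erase X _ hv, filter_false_of_mem fun e he => h0 (mem_powerset.1 hF' he)]
      simp
    · obtain ⟨e, he⟩ := card_eq_one.1 h1
      have heF : e ∈ F ∧ G.Inc v e := by
        rw [← mem_filter (p := G.Inc v), he]; exact mem_singleton_self e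
      have huniq : ∀ e' ∈ F.erase e, ¬ G.Inc v e' := fun e' he' hi => by
        have : e' ∈ F.filter (G.Inc v) := mem_filter.2 ⟨mem_of_mem_erase he', hi⟩
        rw [he, mem_singleton] at this
        exact ne_of_mem_erase he' this
      have := ih (X.erase v) hXv (F.erase e) (fun e' he' u hu => mem_erase.2
        ⟨fun huv => huniq e' he' (huv ▸ hu), hFX e' (mem_of_mem_erase he') u hu⟩)
        (hF.mono (by simp))
      have hcard := card_erase_add_one heF.1
      rw [hX, ← hcard, show n + 1 + ((F.erase e).card + 1) = (n + (F.erase e).card) + 2 by ring,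
        pow_add, ← hXv, ← this]
      conv_lhs => rw [← insert_erase heF.1]
      rw [sum_powerset_insert (notMem_erase e F), neg_one_sq, mul_one]
      -- If `e` is kept, `v` has degree exactly $1$ and its factor is $0$. If `e` is dropped, the
      -- factor $-1$ of `v` cancels the extra sign from `F \ F'`.
      have hB : ∑ F' ∈ (F.erase e).powerset, (-1 : ℝ) ^ (insert e (F.erase e) \ insert e F').card *
          ∏ u ∈ X, ((((insert e F').filter (G.Inc u)).card : ℝ) - 1) = 0 := by
        refine sum_eq_zero fun F' hF' => ?_
        rw [prod_eq_zero hv, mul_zero]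
        rw [filter_insert, if_pos heF.2,
          filter_false_of_mem fun e' he' => huniq e' (mem_powerset.1 hF' he')]
        simp
      rw [hB, add_zero]
      refine sum_congr rfl fun F' hF' => ?_
      have heF' : e ∉ F' := fun h => notMem_erase e F (mem_powerset.1 hF' h)
      rw [← mul_prod_erase X _ hv,
        filter_false_of_mem fun e' he' => huniq e' (mem_powerset.1 hF' he'),
        insert_sdiff_of_notMem _ heF', card_insert_of_notMem
          (fun h => notMem_erase e F (mem_sdiff.1 h).1)]
      rw [pow_succ]
      simp

end Leaf

end RootedGraph

/-! ### Determinants of partial functions -/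

section FunctionalMatrix

variable {U : Type*} [Fintype U] [DecidableEq U]

/-- The matrix `1 - A`, where `A` is the adjacency matrix of the graph of a partial function. -/
def functionalMatrix (g : U → Option U) : Matrix U U ℝ :=
  Matrix.of fun v => Pi.single v 1 - (g v).elim 0 fun u => Pi.single u 1

omit [Fintype U] in
theorem functionalMatrix_apply (g : U → Option U) (v : U) :
    functionalMatrix g v = Pi.single v 1 - (g v).elim 0 fun u => Pi.single u 1 := rfl

/-- The determinant is `1` unless the graph of the partial function has a cycle. -/
theorem det_functionalMatrix_eq_one_or (g : U → Option U) :
    (functionalMatrix g).det = 1 ∨ (functionalMatrix g).det = 0 ∧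
      ∃ X : Finset U, X.Nonempty ∧ (∀ v ∈ X, g v ≠ none) ∧
        ∑ v ∈ X, functionalMatrix g v = 0 := by
  induction hn : (univ.filter fun v => g v ≠ none).card using Nat.strong_induction_on
    generalizing g with
  | _ n ih =>
    subst hn
    by_cases hleaf : ∃ v, g v ≠ none ∧ ∀ u, g u ≠ some v
    · obtain ⟨v, hv, hu⟩ := hleaf
      obtain ⟨w, hw⟩ := Option.ne_none_iff_exists'.1 hv
      have hwv : w ≠ v := fun h => hu v (by rw [hw, h])
      have hrow : ∀ u, u ≠ v →
          functionalMatrix (Function.update g v none) u = functionalMatrix g u := fun u huv => by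
        rw [functionalMatrix_apply, functionalMatrix_apply, Function.update_of_ne huv]
      have hdet : (functionalMatrix g).det = (functionalMatrix (Function.update g v none)).det := by
        have h1 : functionalMatrix (Function.update g v none) =
            (functionalMatrix g).updateRow v (Pi.single v 1) := by
          refine funext fun u => ?_
          by_cases huv : u = v
          · subst huv
            rw [Matrix.updateRow_self, functionalMatrix_apply, Function.update_self]
            simp
          · rw [Matrix.updateRow_ne huv, hrow u huv]
        have h2 : functionalMatrix (Function.update g v none) =
            (functionalMatrix g).updateRow v (functionalMatrix g v + Pi.single w 1) := by
          rw [h1, functionalMatrix_apply g v, hw]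
          simp
        -- By linearity in row `v`, the two determinants differ by one whose row `v` is $e_w$. Its
        -- column `v` is zero, because nothing is mapped to `v` and `w ≠ v`.
        rw [h2, Matrix.det_updateRow_add, Matrix.updateRow_eq_self, left_eq_add]
        refine Matrix.det_eq_zero_of_column_eq_zero v fun u => ?_
        by_cases huv : u = v
        · subst huv
          rw [Matrix.updateRow_self, Pi.single_eq_of_ne hwv.symm]
        · rw [Matrix.updateRow_ne huv, functionalMatrix_apply]
          have := hu u
          rcases hg : g u with _ | x
          · simp [Ne.symm huv]
          · have hxv : x ≠ v := fun h => this (by rw [hg, h])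
            simp [Ne.symm huv, hxv.symm]
      have hlt : (univ.filter fun u => Function.update g v none u ≠ none).card <
          (univ.filter fun u => g u ≠ none).card := by
        refine card_lt_card ⟨fun u hu => ?_, fun h => ?_⟩
        · by_cases huv : u = v
          · simp [huv] at hu
          · simpa [huv] using hu
        · have := h (mem_filter.2 ⟨mem_univ v, hv⟩)
          simp at this
      rcases ih _ hlt _ rfl with h | ⟨h, X, hX, hXg, hsum⟩
      · exact Or.inl (hdet.trans h)
      · have hvX : ∀ u ∈ X, u ≠ v := fun u hu huv => hXg u hu (by simp [huv])
        refine Or.inr ⟨hdet.trans h, X, hX, fun u hu => ?_, ?_⟩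
        · simpa [hvX u hu] using hXg u hu
        · rw [← hsum]
          exact sum_congr rfl fun u hu => (hrow u (hvX u hu)).symm
    · push Not at hleaf
      set X := univ.filter fun v => g v ≠ none with hXdef
      rcases X.eq_empty_or_nonempty with hX | hX
      · left
        have : functionalMatrix g = 1 := by
          refine funext fun v => ?_
          have hv : g v = none := by
            by_contra h
            have : v ∈ X := mem_filter.2 ⟨mem_univ v, h⟩
            simp [hX] at this
          rw [functionalMatrix_apply, hv]
          ext u
          simp [Matrix.one_apply, Pi.single_apply, eq_comm]
        rw [this, Matrix.det_one]
      · right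
        -- Without leaves, the partial function maps its domain onto a set containing the domain,
        -- hence permutes it, and the rows over the domain cancel. The default in `getD` is never
        -- reached on `X`.
        have hsub : X ⊆ X.image fun v => (g v).getD v := by
          intro v hv
          obtain ⟨u, hu⟩ := hleaf v (mem_filter.1 hv).2
          exact mem_image.2 ⟨u, mem_filter.2 ⟨mem_univ u, by simp [hu]⟩, by simp [hu]⟩
        have heq : X = X.image fun v => (g v).getD v :=
          eq_of_subset_of_card_le hsub card_image_le
        have hinj : Set.InjOn (fun v => (g v).getD v) X :=
          card_image_iff.1 (congrArg card heq.symm)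
        have hsum : ∑ v ∈ X, functionalMatrix g v = 0 := by
          simp only [functionalMatrix_apply, sum_sub_distrib]
          rw [sub_eq_zero]
          conv_lhs => rw [heq]
          rw [sum_image hinj]
          refine sum_congr rfl fun v hv => ?_
          obtain ⟨u, hu⟩ := Option.ne_none_iff_exists'.1 (mem_filter.1 hv).2
          simp [hu]
        refine ⟨Matrix.exists_vecMul_eq_zero_iff.1
          ⟨fun v => if v ∈ X then 1 else 0, fun h => ?_, ?_⟩, X, hX, fun v hv =>
            (mem_filter.1 hv).2, hsum⟩
        · obtain ⟨v, hv⟩ := hX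
          simpa [hv] using congrFun h v
        · rw [← hsum, Matrix.vecMul_eq_sum]
          simp only [ite_smul, one_smul, zero_smul]
          exact (sum_filter (· ∈ X) _).symm.trans (sum_congr (by ext; simp) fun _ _ => rfl)

end FunctionalMatrix

/-! ### Counting forests by choices of the vertices -/

namespace RootedGraph

variable {U E : Type*} [DecidableEq U] (G : RootedGraph U E)

/-- The choices of a vertex: nothing or an incident edge in `F`. -/
def choices (F : Finset E) (v : U) : Finset (Option E) := (F.filter (G.Inc v)).insertNone

theorem mem_choices {F : Finset E} {v : U} {c : Option E} :
    c ∈ G.choices F v ↔ ∀ e ∈ c, e ∈ F ∧ G.Inc v e := by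
  simp [choices, mem_insertNone]

/-- The sign of a choice. -/
def choiceSign (c : Option E) : ℝ := c.elim (-1) fun _ => 1

theorem sum_choiceSign (F : Finset E) (v : U) :
    ∑ c ∈ G.choices F v, choiceSign c = ((F.filter (G.Inc v)).card : ℝ) - 1 := by
  rw [choices, sum_insertNone]
  simp [choiceSign]
  ring

variable [Fintype U] [DecidableEq E] [Fintype E]

/-- The set of the chosen edges. -/
def chosen (f : U → Option E) : Finset E := univ.filter fun e => ∃ v, f v = some e

omit [DecidableEq U] in
theorem mem_chosen {f : U → Option E} {e : E} : e ∈ chosen f ↔ ∃ v, f v = some e := by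
  simp [chosen]

/-- The sum is the expansion of $\prod_{e\in F}(1+c_e)$ with $c_e=0$ on `S` and $c_e=-1$ off `S`. -/
theorem _root_.Finset.sum_powerset_neg_one_pow_card_sdiff {E : Type*} [DecidableEq E]
    {S F : Finset E} (hSF : S ⊆ F) :
    ∑ F' ∈ F.powerset, (if S ⊆ F' then (-1 : ℝ) ^ (F \ F').card else 0) =
      if S = F then 1 else 0 := by
  have h := prod_add (fun _ : E => (1 : ℝ)) (fun e => if e ∈ S then 0 else -1) F
  calc _ = ∑ t ∈ F.powerset, (∏ e ∈ t, (1 : ℝ)) * ∏ e ∈ F \ t, if e ∈ S then 0 else -1 := by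
        refine sum_congr rfl fun t _ => ?_
        rw [prod_const_one, one_mul]
        split_ifs with hS
        · rw [prod_congr rfl fun e he => if_neg fun heS => (mem_sdiff.1 he).2 (hS heS), prod_const]
        · obtain ⟨e, heS, het⟩ := not_subset.1 hS
          symm
          exact prod_eq_zero (i := e) (mem_sdiff.2 ⟨hSF heS, het⟩) (if_pos heS)
    _ = ∏ e ∈ F, ((1 : ℝ) + if e ∈ S then 0 else -1) := h.symm
    _ = _ := by
        split_ifs with hS
        · subst hS
          exact prod_eq_one fun e he => by simp [he]
        · obtain ⟨e, heF, heS⟩ := not_subset.1 fun h => hS (hSF.antisymm h)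
          exact prod_eq_zero heF (by simp [heS])

/-- The signed count of the ways to let each vertex choose an incident edge or nothing, so that the
set of the chosen edges is a given forest. -/
theorem sum_prod_choiceSign_of_chosen_eq {F : Finset E}
    (hF : LinearIndepOn ℝ G.vec (F : Set E)) :
    ∑ f ∈ Fintype.piFinset (G.choices univ) with chosen f = F, ∏ v, choiceSign (f v) =
      (-1) ^ (Fintype.card U + F.card) := by
  rw [← card_univ, ← G.sum_powerset_prod_degree_sub_one _ univ rfl F (fun _ _ _ _ => mem_univ _) hF]
  symm
  -- A product of factors $\deg_{F'}(v)-1$ counts the choices within `F'`; inclusion–exclusion over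
  -- `F'` then isolates those that use all of `F`.
  have hpi : ∀ F' ∈ F.powerset, (∏ v, (((F'.filter (G.Inc v)).card : ℝ) - 1)) =
      ∑ f ∈ Fintype.piFinset (G.choices F),
        if chosen f ⊆ F' then ∏ v, choiceSign (f v) else 0 := by
    intro F' hF'
    simp only [← sum_choiceSign]
    rw [prod_univ_sum, ← sum_filter]
    refine sum_congr ?_ fun _ _ => rfl
    ext f
    simp only [Fintype.mem_piFinset, mem_choices, mem_filter, subset_iff, mem_chosen]
    constructor
    · refine fun h => ⟨fun v e he => ⟨mem_powerset.1 hF' (h v e he).1, (h v e he).2⟩, ?_⟩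
      rintro e ⟨v, hv⟩
      exact (h v e hv).1
    · exact fun h v e he => ⟨h.2 ⟨v, he⟩, (h.1 v e he).2⟩
  rw [sum_congr rfl fun F' hF' => by rw [hpi F' hF', mul_sum], sum_comm]
  have hpi2 : (Fintype.piFinset (G.choices univ)).filter (fun f => chosen f = F) =
      (Fintype.piFinset (G.choices F)).filter (fun f => chosen f = F) := by
    ext f
    simp only [mem_filter, and_congr_left_iff, Fintype.mem_piFinset, mem_choices]
    rintro rfl
    simp only [mem_univ, true_and, mem_chosen]
    exact forall_congr' fun v => forall_congr' fun e => forall_congr' fun he =>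
      ⟨fun h => ⟨⟨v, he⟩, h⟩, fun h => h.2⟩
  rw [hpi2, sum_filter]
  refine sum_congr rfl fun f hf => ?_
  have hsub : chosen f ⊆ F := fun e he => by
    obtain ⟨v, hv⟩ := mem_chosen.1 he
    exact (G.mem_choices.1 (Fintype.mem_piFinset.1 hf v) e hv).1
  have h := congrArg (fun x : ℝ => x * ∏ v, choiceSign (f v))
    (sum_powerset_neg_one_pow_card_sdiff hsub)
  simp only [sum_mul, ite_mul, one_mul, zero_mul] at h
  rw [← h]
  exact sum_congr rfl fun F' _ => by split_ifs <;> simp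

open Classical in
/-- Forests can be counted by letting each vertex choose an incident edge or nothing. -/
theorem signedIndepSum_vec_eq_sum_choices :
    (-1 : ℝ) ^ Fintype.card U * (signedIndepSum G.vec : ℝ) =
      ∑ f ∈ Fintype.piFinset (G.choices univ),
        if LinearIndepOn ℝ G.vec (chosen f : Set E) then ∏ v, choiceSign (f v) else 0 := by
  rw [signedIndepSum, Int.cast_sum, mul_sum, ← sum_fiberwise_of_maps_to (g := chosen)
    (t := univ) (fun _ _ => mem_univ _), sum_filter]
  refine sum_congr rfl fun F _ => ?_
  split_ifs with hF
  · push_cast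
    rw [← pow_add, ← G.sum_prod_choiceSign_of_chosen_eq hF]
    refine sum_congr rfl fun f hf => ?_
    rw [(mem_filter.1 hf).2, if_pos hF]
  · refine (sum_eq_zero fun f hf => ?_).symm
    rw [(mem_filter.1 hf).2, if_neg hF]

end RootedGraph

/-! ### Detecting forests by determinants, and the sum over matchings -/

namespace RootedGraph

variable {U E : Type*} [DecidableEq U] (G : RootedGraph U E)

theorem vec_mul_self {v : U} {e : E} (h : G.Inc v e) : G.vec e v * G.vec e v = 1 := by
  have h1 := congrFun (G.vec_smul_vec h) v
  have hne := G.head_ne e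
  rw [Pi.smul_apply, smul_eq_mul] at h1
  rw [h1]
  by_cases ht : G.tail e = v
  · subst ht
    rcases hh : G.head e with _ | u
    · simp [other, hh]
    · have : G.tail e ≠ u := fun hu => hne (by rw [hh, hu])
      simp [other, hh, this]
  · simp [other, ht, Ne.symm ht]

/-- The vertex `v` is an end point of an edge in `M`. -/
abbrev Covered (M : Finset E) (v : U) : Prop := ∃ e ∈ M, G.Inc v e

/-- The row of a choice of the vertex `v`. -/
def choiceRow (v : U) (c : Option E) : U → ℝ := c.elim (Pi.single v 1) fun e => G.vec e v • G.vec e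

/-- The matrix of the choices of the vertices that are not covered by `M`. -/
def choiceMatrix (M : Finset E) (f : U → Option E) : Matrix U U ℝ :=
  Matrix.of fun v => if G.Covered M v then Pi.single v 1 else G.choiceRow v (f v)

theorem choiceMatrix_apply (M : Finset E) (f : U → Option E) (v : U) :
    G.choiceMatrix M f v = if G.Covered M v then Pi.single v 1 else G.choiceRow v (f v) := rfl

variable [Fintype U] [DecidableEq E] [Fintype E]

/-- The non-root edges that are chosen by both end points. -/
def reciprocal (f : U → Option E) : Finset E :=
  univ.filter fun e => G.head e ≠ none ∧ ∀ v, G.Inc v e → f v = some e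

variable {G} {f : U → Option E}

theorem mem_reciprocal {e : E} :
    e ∈ G.reciprocal f ↔ G.head e ≠ none ∧ ∀ v, G.Inc v e → f v = some e := by
  simp [reciprocal]

omit [DecidableEq E] in
theorem inc_of_eq_some (hf : f ∈ Fintype.piFinset (G.choices univ)) {v : U} {e : E}
    (h : f v = some e) : G.Inc v e :=
  (G.mem_choices.1 (Fintype.mem_piFinset.1 hf v) e h).2

theorem mem_reciprocal_of_ne (hf : f ∈ Fintype.piFinset (G.choices univ)) {u v : U} {e : E}
    (hu : f u = some e) (hv : f v = some e) (huv : u ≠ v) : e ∈ G.reciprocal f := by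
  have h1 := inc_of_eq_some hf hu
  have h2 := inc_of_eq_some hf hv
  rw [mem_reciprocal]
  grind

omit [DecidableEq E] in
theorem choiceMatrix_eq_functionalMatrix (hf : f ∈ Fintype.piFinset (G.choices univ))
    (M : Finset E) : G.choiceMatrix M f = functionalMatrix fun v =>
      if G.Covered M v then none else (f v).bind (G.other v) := by
  refine funext fun v => ?_
  rw [choiceMatrix_apply, functionalMatrix_apply]
  split_ifs with h
  · simp
  · rcases hv : f v with _ | e
    · simp [choiceRow]
    · exact G.vec_smul_vec (inc_of_eq_some hf hv)

/-- The edge `e` leaves an unbroken 2-cycle: its two end points are uncovered and their rows are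
negatives of each other. -/
theorem det_choiceMatrix_eq_zero_of_notMem {M : Finset E} (hM : M ⊆ G.reciprocal f) {e : E} (he : e ∈ G.reciprocal f) (heM : e ∉ M) :
    (G.choiceMatrix M f).det = 0 := by
  obtain ⟨hne, hfe⟩ := mem_reciprocal.1 he
  obtain ⟨u, hu⟩ := Option.ne_none_iff_exists'.1 hne
  have hcov : ∀ v, G.Inc v e → ¬ G.Covered M v := by
    rintro v hv ⟨e', he', hve'⟩
    have h1 := (mem_reciprocal.1 (hM he')).2 v hve'
    rw [hfe v hv, Option.some_inj] at h1
    exact heM (h1 ▸ he')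
  have htu : G.tail e ≠ u := fun h => G.head_ne e (by rw [hu, h])
  have hit : G.Inc (G.tail e) e := Or.inl rfl
  have hiu : G.Inc u e := Or.inr hu
  refine Matrix.exists_vecMul_eq_zero_iff.1
    ⟨Pi.single (G.tail e) 1 + Pi.single u 1, fun h => ?_, ?_⟩
  · have := congrFun h u
    simp [htu.symm] at this
  · rw [Matrix.add_vecMul, Matrix.single_one_vecMul, Matrix.single_one_vecMul]
    change G.choiceMatrix M f _ + G.choiceMatrix M f _ = 0
    rw [choiceMatrix_apply, choiceMatrix_apply, if_neg (hcov _ hit), if_neg (hcov _ hiu),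
      hfe _ hit, hfe _ hiu]
    change G.vec e _ • G.vec e + G.vec e _ • G.vec e = 0
    rw [G.vec_smul_vec hit, G.vec_smul_vec hiu]
    simp [other, hu, htu]

/-- Otherwise some rows of uncovered vertices sum to zero. An edge chosen twice is reciprocal and
its ends are covered, so each edge occurs at most once in this sum: a nontrivial relation among the
chosen edges. -/
theorem det_choiceMatrix_reciprocal_eq_one (hf : f ∈ Fintype.piFinset (G.choices univ))
    (hind : LinearIndepOn ℝ G.vec (chosen f : Set E)) :
    (G.choiceMatrix (G.reciprocal f) f).det = 1 := by
  have hmat := choiceMatrix_eq_functionalMatrix hf (G.reciprocal f)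
  rw [hmat]
  refine (det_functionalMatrix_eq_one_or _).resolve_right ?_
  rintro ⟨-, X, ⟨x, hx⟩, hX, hsum⟩
  rw [← hmat] at hsum
  have hcov : ∀ v ∈ X, ¬ G.Covered (G.reciprocal f) v := fun v hv h => hX v hv (if_pos h)
  have hsome : ∀ v ∈ X, ∃ e, f v = some e := fun v hv => by
    have h := hX v hv
    rw [if_neg (hcov v hv)] at h
    rcases hfv : f v with _ | e
    · simp [hfv] at h
    · exact ⟨e, rfl⟩
  have hrel : ∑ e ∈ chosen f, (∑ v ∈ X, if f v = some e then G.vec e v else 0) • G.vec e = 0 := by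
    simp only [sum_smul]
    rw [sum_comm, ← hsum]
    refine sum_congr rfl fun v hv => ?_
    obtain ⟨e, he⟩ := hsome v hv
    rw [sum_eq_single e, choiceMatrix_apply, if_neg (hcov v hv), he, if_pos rfl]
    · rfl
    · intro e' _ hee'
      rw [he, if_neg fun h => hee' (Option.some_inj.1 h).symm, zero_smul]
    · exact fun h => absurd (mem_chosen.2 ⟨v, he⟩) h
  obtain ⟨e, he⟩ := hsome x hx
  have h0 := linearIndepOn_finset_iff.1 hind _ hrel e (mem_chosen.2 ⟨x, he⟩)
  rw [sum_eq_single x, if_pos he] at h0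
  · exact G.vec_apply_ne_zero (inc_of_eq_some hf he) h0
  · intro v hv hvx
    refine if_neg fun h => ?_
    exact hcov v hv ⟨e, mem_reciprocal_of_ne hf h he hvx, inc_of_eq_some hf h⟩
  · exact fun h => absurd hx h

/-- A linear relation among the chosen edges is converted into a vector of the left kernel. -/
theorem det_choiceMatrix_reciprocal_eq_zero (hf : f ∈ Fintype.piFinset (G.choices univ))
    (hdep : ¬ LinearIndepOn ℝ G.vec (chosen f : Set E)) :
    (G.choiceMatrix (G.reciprocal f) f).det = 0 := by
  set M := G.reciprocal f with hMdef
  have hMsub : M ⊆ chosen f := fun e he =>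
    mem_chosen.2 ⟨G.tail e, (mem_reciprocal.1 he).2 _ (Or.inl rfl)⟩
  rw [linearIndepOn_finset_iff] at hdep
  push Not at hdep
  obtain ⟨c, hc, e₀, he₀, hce₀⟩ := hdep
  set S : U → ℝ := ∑ e ∈ M, c e • G.vec e with hS
  have hScov : ∀ v, ¬ G.Covered M v → S v = 0 := fun v hv => by
    rw [hS, Finset.sum_apply]
    exact sum_eq_zero fun e he => by
      rw [Pi.smul_apply, G.vec_apply_eq_zero fun h => hv ⟨e, he, h⟩, smul_zero]
  have hnotM : ∀ {v e}, ¬ G.Covered M v → f v = some e → e ∉ M := fun hv he heM =>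
    hv ⟨_, heM, inc_of_eq_some hf he⟩
  have hcov : ∀ {v e}, f v = some e → e ∉ M → ¬ G.Covered M v := by
    rintro v e he heM ⟨e', he', hi⟩
    have := (mem_reciprocal.1 he').2 v hi
    rw [he, Option.some_inj] at this
    exact heM (this ▸ he')
  -- At an uncovered vertex choosing `e`, the weight turns the row into `c e • G.vec e`, since the
  -- sign squares to $1$. At covered vertices, unit rows allow the part `S` of the relation
  -- supported on `M` to be written coordinate by coordinate.
  let w : U → ℝ := fun v => if G.Covered M v then S v else (f v).elim 0 fun e => c e * G.vec e v
  refine Matrix.exists_vecMul_eq_zero_iff.1 ⟨w, fun hw => hce₀ ?_, ?_⟩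
  · have hout : ∀ e ∈ chosen f, e ∉ M → c e = 0 := fun e he heM => by
      obtain ⟨v, hv⟩ := mem_chosen.1 he
      have h := congrFun hw v
      simp only [w, if_neg (hcov hv heM), hv, Option.elim_some, Pi.zero_apply] at h
      exact (mul_eq_zero.1 h).resolve_right (G.vec_apply_ne_zero (inc_of_eq_some hf hv))
    by_cases heM : e₀ ∈ M
    · have hcv : G.Covered M (G.tail e₀) := ⟨e₀, heM, Or.inl rfl⟩
      have h := congrFun hw (G.tail e₀)
      simp only [w, if_pos hcv, Pi.zero_apply] at h
      rw [hS, Finset.sum_apply, sum_eq_single e₀, Pi.smul_apply, smul_eq_mul] at h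
      · exact (mul_eq_zero.1 h).resolve_right (G.vec_apply_ne_zero (Or.inl rfl))
      · intro e he hne
        rw [Pi.smul_apply, G.vec_apply_eq_zero, smul_zero]
        intro hi
        have h1 := (mem_reciprocal.1 he).2 _ hi
        rw [(mem_reciprocal.1 heM).2 _ (Or.inl rfl), Option.some_inj] at h1
        exact hne h1.symm
      · exact fun h => absurd heM h
    · exact hout e₀ he₀ heM
  · rw [Matrix.vecMul_eq_sum, ← sum_filter_add_sum_filter_not univ (G.Covered M)]
    have h1 : ∑ v with G.Covered M v, w v • G.choiceMatrix M f v = S := by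
      ext u
      rw [Finset.sum_apply]
      have : ∀ v ∈ univ.filter (G.Covered M),
          (w v • G.choiceMatrix M f v) u = if u = v then S v else 0 := fun v hv => by
        have hv := (mem_filter.1 hv).2
        rw [Pi.smul_apply, choiceMatrix_apply, if_pos hv]
        simp [w, if_pos hv, Pi.single_apply]
      rw [sum_congr rfl this, sum_ite_eq]
      split_ifs with h
      · rfl
      · exact (hScov u fun h' => h (mem_filter.2 ⟨mem_univ u, h'⟩)).symm
    have h2 : ∑ v with ¬ G.Covered M v, w v • G.choiceMatrix M f v =
        ∑ e ∈ chosen f \ M, c e • G.vec e := by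
      have h3 : ∀ v ∈ univ.filter (fun v => ¬ G.Covered M v), w v • G.choiceMatrix M f v =
          ∑ e ∈ chosen f \ M, if f v = some e then c e • G.vec e else 0 := fun v hv => by
        have hv := (mem_filter.1 hv).2
        rw [choiceMatrix_apply, if_neg hv]
        simp only [w, if_neg hv]
        rcases hfv : f v with _ | e
        · simp
        · have heM : e ∈ chosen f \ M :=
            mem_sdiff.2 ⟨mem_chosen.2 ⟨v, hfv⟩, hnotM hv hfv⟩
          rw [sum_eq_single_of_mem e heM fun e' _ hne =>
            if_neg fun h => hne (Option.some_inj.1 h).symm, if_pos rfl]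
          simp only [choiceRow, Option.elim_some, smul_smul]
          rw [mul_assoc, G.vec_mul_self (inc_of_eq_some hf hfv), mul_one]
      rw [sum_congr rfl h3, sum_comm]
      refine sum_congr rfl fun e he => ?_
      obtain ⟨he, heM⟩ := mem_sdiff.1 he
      obtain ⟨v, hv⟩ := mem_chosen.1 he
      rw [sum_eq_single_of_mem v (mem_filter.2 ⟨mem_univ v, hcov hv heM⟩), if_pos hv]
      intro u _ huv
      exact if_neg fun h => heM (mem_reciprocal_of_ne hf h hv huv)
    have h4 : ∑ v with G.Covered M v, w v • G.choiceMatrix M f v +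
        ∑ v with ¬ G.Covered M v, w v • G.choiceMatrix M f v = 0 := by
      rw [h1, h2, hS, add_comm, sum_sdiff hMsub, hc]
    exact h4

open Classical in
theorem sum_det_choiceMatrix (hf : f ∈ Fintype.piFinset (G.choices univ)) :
    ∑ M ∈ (G.reciprocal f).powerset, (G.choiceMatrix M f).det =
      if LinearIndepOn ℝ G.vec (chosen f : Set E) then 1 else 0 := by
  rw [sum_eq_single_of_mem (G.reciprocal f) (mem_powerset_self _)]
  · split_ifs with h
    · exact det_choiceMatrix_reciprocal_eq_one hf h
    · exact det_choiceMatrix_reciprocal_eq_zero hf h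
  · intro M hM hne
    obtain ⟨e, he, heM⟩ := not_subset.1 fun h => hne ((mem_powerset.1 hM).antisymm h)
    exact det_choiceMatrix_eq_zero_of_notMem (mem_powerset.1 hM) he heM

variable (G)

/-- `M` consists of pairwise disjoint edges not incident to the root. -/
def IsMatching (M : Finset E) : Prop :=
  (∀ e ∈ M, G.head e ≠ none) ∧ ∀ e ∈ M, ∀ e' ∈ M, ∀ v, G.Inc v e → G.Inc v e' → e = e'

/-- The Laplace matrix with the root removed, minus the identity matrix, with the rows of the
covered vertices replaced by those of the identity matrix. -/
def shiftedLaplacian (M : Finset E) : Matrix U U ℝ :=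
  Matrix.of fun v => if G.Covered M v then Pi.single v 1 else
    ∑ e, G.vec e v • G.vec e - Pi.single v 1

omit [Fintype U] [DecidableEq E] in
theorem sum_choiceSign_smul_choiceRow (v : U) :
    ∑ c ∈ G.choices univ v, choiceSign c • G.choiceRow v c =
      ∑ e, G.vec e v • G.vec e - Pi.single v 1 := by
  rw [choices, sum_insertNone]
  simp only [choiceSign, choiceRow, Option.elim_none, Option.elim_some, one_smul, neg_smul]
  rw [sum_filter, neg_add_eq_sub]
  congr 1
  refine sum_congr rfl fun e _ => ?_
  split_ifs with h
  · rfl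
  · rw [G.vec_apply_eq_zero h, zero_smul]

open Classical in
/-- The signed count of forests as a sum of determinants over the matchings. -/
theorem signedIndepSum_vec_eq_sum_det :
    (-1 : ℝ) ^ Fintype.card U * (signedIndepSum G.vec : ℝ) =
      ∑ M ∈ univ.filter G.IsMatching, (G.shiftedLaplacian M).det := by
  rw [signedIndepSum_vec_eq_sum_choices]
  have h1 : ∀ f ∈ Fintype.piFinset (G.choices univ),
      (if LinearIndepOn ℝ G.vec (chosen f : Set E) then ∏ v, choiceSign (f v) else 0) =
        ∑ M : Finset E, if M ⊆ G.reciprocal f then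
          (∏ v, choiceSign (f v)) * (G.choiceMatrix M f).det else 0 := by
    intro f hf
    rw [← mul_boole, ← sum_det_choiceMatrix hf, mul_sum, ← sum_filter]
    refine sum_congr ?_ fun _ _ => rfl
    ext M
    simp
  rw [sum_congr rfl h1, sum_comm, sum_filter]
  refine sum_congr rfl fun M _ => ?_
  split_ifs with hM
  -- For a matching `M`, the condition `M ⊆ G.reciprocal f` prescribes `f` at the covered vertices
  -- and leaves the others free, so the admissible choices form a product set.
  · let A : U → Finset (Option E) := fun v =>
      if G.Covered M v then (M.filter (G.Inc v)).map Function.Embedding.some else G.choices univ v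
    have hA : (Fintype.piFinset (G.choices univ)).filter (fun f => M ⊆ G.reciprocal f) =
        Fintype.piFinset A := by
      ext f
      simp only [mem_filter, Fintype.mem_piFinset]
      constructor
      · rintro ⟨hf, hMf⟩ v
        by_cases hv : G.Covered M v
        · obtain ⟨e, he, hi⟩ := hv
          simp only [A, if_pos (show G.Covered M v from ⟨e, he, hi⟩), mem_map]
          exact ⟨e, mem_filter.2 ⟨he, hi⟩, ((mem_reciprocal.1 (hMf he)).2 v hi).symm⟩
        · simpa only [A, if_neg hv] using hf v
      · intro h
        have h' : ∀ v e, e ∈ M → G.Inc v e → f v = some e := fun v e he hi => by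
          have := h v
          simp only [A, if_pos (show G.Covered M v from ⟨e, he, hi⟩), mem_map] at this
          obtain ⟨e', he', hfe⟩ := this
          rw [← hfe, hM.2 e he e' (mem_filter.1 he').1 v hi (mem_filter.1 he').2]
          rfl
        refine ⟨fun v => ?_, fun e he => mem_reciprocal.2 ⟨hM.1 e he, fun v hi => h' v e he hi⟩⟩
        by_cases hv : G.Covered M v
        · obtain ⟨e, he, hi⟩ := hv
          rw [h' v e he hi, mem_choices]
          intro e' he'
          rw [Option.mem_some_iff.1 he'] at hi
          exact ⟨mem_univ _, hi⟩
        · simpa only [A, if_neg hv] using h v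
    rw [← sum_filter, hA]
    let row : U → Option E → U → ℝ := fun v c =>
      choiceSign c • if G.Covered M v then Pi.single v 1 else G.choiceRow v c
    -- Multilinearity in the rows turns the sum over the product set into a single determinant.
    have hdet := (Matrix.detRowAlternating (n := U) (R := ℝ)).toMultilinearMap.map_sum_finset row A
    have hL : (fun v => ∑ c ∈ A v, row v c) = G.shiftedLaplacian M := by
      refine funext fun v => ?_
      change _ = if G.Covered M v then Pi.single v 1 else _
      by_cases hv : G.Covered M v
      · obtain ⟨e, he, hi⟩ := hv
        have hv : G.Covered M v := ⟨e, he, hi⟩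
        have hsing : M.filter (G.Inc v) = {e} := by
          ext e'
          simp only [mem_filter, mem_singleton]
          exact ⟨fun h => (hM.2 e he e' h.1 v hi h.2).symm, fun h => h ▸ ⟨he, hi⟩⟩
        simp only [row, A, if_pos hv, hsing]
        simp [choiceSign]
      · simp only [row, A, if_neg hv]
        exact G.sum_choiceSign_smul_choiceRow v
    rw [hL] at hdet
    refine Eq.trans (sum_congr rfl fun f _ => ?_) hdet.symm
    exact ((Matrix.detRowAlternating (n := U) (R := ℝ)).toMultilinearMap.map_smul_univ
      (fun v => choiceSign (f v)) (G.choiceMatrix M f)).symm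
  · refine sum_eq_zero fun f _ => if_neg fun hMf => hM ⟨fun e he => (mem_reciprocal.1 (hMf he)).1, ?_⟩
    intro e he e' he' v hi hi'
    have h1 := (mem_reciprocal.1 (hMf he)).2 v hi
    rw [(mem_reciprocal.1 (hMf he')).2 v hi', Option.some_inj] at h1
    exact h1.symm

end RootedGraph

/-! ### The determinant for a bipartite graph -/

section Determinant

variable {α β : Type*} [Fintype α] [Fintype β] [DecidableEq α] [DecidableEq β]

/-- The matrix with diagonal entries `x` (`y`) in the rows of `P` (of `Q`), entries `-1` where these
rows meet the columns of the other part, and the rows of the identity matrix elsewhere. -/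
def bipartiteMatrix (P : Finset α) (Q : Finset β) (x y : ℝ) : Matrix (α ⊕ β) (α ⊕ β) ℝ :=
  Matrix.fromBlocks (Matrix.diagonal fun i => if i ∈ P then x else 1)
    (Matrix.of fun i _ => if i ∈ P then -1 else 0) (Matrix.of fun j _ => if j ∈ Q then -1 else 0)
    (Matrix.diagonal fun j => if j ∈ Q then y else 1)

/-- The Schur complement of the first block is a diagonal matrix plus one of rank one, so the matrix
determinant lemma applies. For empty `P` or `Q` the truncated exponent is harmless: its factor is
$0$. -/
theorem det_bipartiteMatrix_of_ne_zero (P : Finset α) (Q : Finset β) {x y : ℝ} (hx : x ≠ 0)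
    (hy : y ≠ 0) : (bipartiteMatrix P Q x y).det =
      x ^ P.card * y ^ Q.card - P.card * Q.card * x ^ (P.card - 1) * y ^ (Q.card - 1) := by
  have hd : ∀ (s : Finset α) (z : ℝ), z ≠ 0 → ∀ i, (if i ∈ s then z else 1) ≠ 0 := by
    intro s z hz i
    split_ifs <;> simp [hz]
  have he : ∀ (s : Finset β) (z : ℝ), z ≠ 0 → ∀ i, (if i ∈ s then z else 1) ≠ 0 := by
    intro s z hz i
    split_ifs <;> simp [hz]
  let iA : Invertible (Matrix.diagonal fun i => if i ∈ P then x else (1 : ℝ)) :=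
    invertibleOfLeftInverse _ (Matrix.diagonal fun i => (if i ∈ P then x else 1)⁻¹) (by
      rw [Matrix.diagonal_mul_diagonal]
      simp [hd P x hx])
  have hinv : (⅟ (Matrix.diagonal fun i => if i ∈ P then x else (1 : ℝ))) =
      Matrix.diagonal fun i => (if i ∈ P then x else 1)⁻¹ := rfl
  have hpow : ∀ (z : ℝ) (a : ℕ), z ≠ 0 → (a : ℝ) * z ^ (a - 1) = a * z⁻¹ * z ^ a := by
    intro z a hz
    rcases a with _ | a
    · simp
    · rw [pow_succ, Nat.add_sub_cancel]
      field_simp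
  rw [bipartiteMatrix, Matrix.det_fromBlocks₁₁, hinv, Matrix.det_diagonal]
  have hS : (Matrix.diagonal fun j => if j ∈ Q then y else (1 : ℝ)) -
      (Matrix.of fun j (_ : α) => if j ∈ Q then (-1 : ℝ) else 0) *
        (Matrix.diagonal fun i => (if i ∈ P then x else 1)⁻¹) *
        (Matrix.of fun i (_ : β) => if i ∈ P then (-1 : ℝ) else 0) =
      (Matrix.diagonal fun j => if j ∈ Q then y else 1) +
        Matrix.replicateCol Unit (fun j => if j ∈ Q then -(P.card * x⁻¹) else 0) *
          Matrix.replicateRow Unit (fun _ : β => (1 : ℝ)) := by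
    rw [sub_eq_add_neg]
    congr 1
    ext j j'
    rw [Matrix.neg_apply, Matrix.mul_apply]
    simp only [Matrix.mul_diagonal, Matrix.of_apply]
    by_cases hj : j ∈ Q
    · simp only [hj, if_true, neg_mul, one_mul, mul_ite, mul_neg, mul_one, mul_zero, neg_neg,
        sum_ite_mem, univ_inter, Matrix.mul_apply, Matrix.replicateCol_apply,
        Matrix.replicateRow_apply, univ_unique, sum_singleton]
      rw [sum_congr rfl fun i hi => by rw [if_pos hi], sum_const, nsmul_eq_mul]
    · simp [hj, Matrix.mul_apply]
  rw [hS, Matrix.det_add_replicateCol_mul_replicateRow, Matrix.det_diagonal]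
  · have h1 : (Matrix.diagonal fun j => if j ∈ Q then y else (1 : ℝ))⁻¹ =
        Matrix.diagonal fun j => (if j ∈ Q then y else 1)⁻¹ := by
      refine Matrix.inv_eq_left_inv ?_
      rw [Matrix.diagonal_mul_diagonal]
      simp [he Q y hy]
    rw [h1, Matrix.det_unique]
    rw [Matrix.add_apply, Matrix.mul_apply]
    simp only [Matrix.mul_diagonal, Matrix.replicateRow_apply,
      Matrix.replicateCol_apply, Matrix.one_apply_eq, one_mul]
    have h2 : ∑ j, (if j ∈ Q then y else 1)⁻¹ * (if j ∈ Q then -(P.card * x⁻¹) else 0) =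
        -(Q.card * y⁻¹ * (P.card * x⁻¹)) := by
      simp only [mul_ite, mul_zero, sum_ite_mem, univ_inter]
      rw [sum_congr rfl fun j hj => by rw [if_pos hj], sum_const, nsmul_eq_mul]
      ring
    rw [h2]
    simp only [prod_ite_mem, univ_inter, prod_const]
    linear_combination (Q.card * y ^ (Q.card - 1) : ℝ) * hpow x P.card hx +
      (P.card * x⁻¹ * x ^ P.card : ℝ) * hpow y Q.card hy
  · rw [Matrix.det_diagonal]
    exact IsUnit.mk0 _ (prod_ne_zero_iff.2 fun j _ => he Q y hy j)

omit [Fintype α] [Fintype β] in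
theorem continuous_bipartiteMatrix (P : Finset α) (Q : Finset β) :
    Continuous fun z : ℝ × ℝ => bipartiteMatrix P Q z.1 z.2 := by
  refine Continuous.matrix_fromBlocks (Continuous.matrix_diagonal ?_) continuous_const
    continuous_const (Continuous.matrix_diagonal ?_)
  · refine continuous_pi fun i => ?_
    split_ifs
    · exact continuous_fst
    · exact continuous_const
  · refine continuous_pi fun i => ?_
    split_ifs
    · exact continuous_snd
    · exact continuous_const

/-- Both sides are continuous and agree on the dense set where $x$ and $y$ are nonzero. -/
theorem det_bipartiteMatrix (P : Finset α) (Q : Finset β) (x y : ℝ) :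
    (bipartiteMatrix P Q x y).det =
      x ^ P.card * y ^ Q.card - P.card * Q.card * x ^ (P.card - 1) * y ^ (Q.card - 1) := by
  have hd : Dense (({0}ᶜ : Set ℝ) ×ˢ ({0}ᶜ : Set ℝ)) :=
    (dense_compl_singleton 0).prod (dense_compl_singleton 0)
  have := Continuous.ext_on hd (continuous_bipartiteMatrix P Q).matrix_det
    (g := fun z : ℝ × ℝ => z.1 ^ P.card * z.2 ^ Q.card -
      P.card * Q.card * z.1 ^ (P.card - 1) * z.2 ^ (Q.card - 1)) (by fun_prop)
    fun z hz => det_bipartiteMatrix_of_ne_zero P Q hz.1 hz.2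
  exact congrFun this (x, y)

end Determinant

/-! ### The rooted complete bipartite graph -/

section RootedBipartite

variable (m n k l : ℕ)

/-- The complete bipartite graph with a root that is joined by `k` edges to each vertex of the
first part and by `l` edges to each vertex of the second part. -/
def rootedBipartite :
    RootedGraph (Fin m ⊕ Fin n) ((Fin m × Fin n) ⊕ (Fin m × Fin k) ⊕ (Fin n × Fin l)) where
  tail
    | Sum.inl e => Sum.inl e.1
    | Sum.inr (Sum.inl e) => Sum.inl e.1
    | Sum.inr (Sum.inr e) => Sum.inr e.1
  head
    | Sum.inl e => some (Sum.inr e.2)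
    | Sum.inr _ => none
  head_ne := by rintro (e | e | e) <;> simp

variable {m n}

/-- The vertices of the first part that are not covered. -/
def uncoveredLeft (M : Finset (Fin m × Fin n)) : Finset (Fin m) :=
  univ.filter fun i => ∀ e ∈ M, e.1 ≠ i

/-- The vertices of the second part that are not covered. -/
def uncoveredRight (M : Finset (Fin m × Fin n)) : Finset (Fin n) :=
  univ.filter fun j => ∀ e ∈ M, e.2 ≠ j

theorem covered_inl_iff (M : Finset (Fin m × Fin n)) (i : Fin m) :
    (rootedBipartite m n k l).Covered (M.map Function.Embedding.inl) (Sum.inl i) ↔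
      i ∉ uncoveredLeft M := by
  simp [RootedGraph.Covered, RootedGraph.Inc, uncoveredLeft]
  simp [rootedBipartite]

theorem covered_inr_iff (M : Finset (Fin m × Fin n)) (j : Fin n) :
    (rootedBipartite m n k l).Covered (M.map Function.Embedding.inl) (Sum.inr j) ↔
      j ∉ uncoveredRight M := by
  simp [RootedGraph.Covered, RootedGraph.Inc, uncoveredRight]
  simp [rootedBipartite]

/-- The vertices of the two parts have degrees $n+k$ and $m+l$; subtracting the identity lowers
these diagonal entries by $1$. -/
theorem shiftedLaplacian_rootedBipartite (M : Finset (Fin m × Fin n)) :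
    (rootedBipartite m n k l).shiftedLaplacian (M.map Function.Embedding.inl) =
      bipartiteMatrix (uncoveredLeft M) (uncoveredRight M) ((n : ℝ) + k - 1) ((m : ℝ) + l - 1) := by
  have hif : ∀ (b : Prop) [Decidable b] (r s : Fin m ⊕ Fin n → ℝ) u,
      (if b then r else s) u = if b then r u else s u := fun b _ r s u => by split_ifs <;> rfl
  ext v u
  change (if (rootedBipartite m n k l).Covered (M.map Function.Embedding.inl) v then
    Pi.single v 1 else _ : Fin m ⊕ Fin n → ℝ) u = _
  rw [hif]
  rcases v with i | j
  · rw [if_congr (covered_inl_iff k l M i) rfl rfl]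
    by_cases hi : i ∈ uncoveredLeft M
    · rcases u with i' | j'
      · simp [hi, bipartiteMatrix, Fintype.sum_sum_type, Fintype.sum_prod_type, rootedBipartite,
          RootedGraph.vec, Matrix.diagonal_apply, Pi.single_apply]
        by_cases h : i' = i
        · simp [h]
        · simp [h, Ne.symm h]
      · simp [hi, bipartiteMatrix, Fintype.sum_sum_type, Fintype.sum_prod_type, rootedBipartite,
          RootedGraph.vec, Pi.single_apply]
    · rcases u with i' | j'
      · simp [hi, bipartiteMatrix, Matrix.diagonal_apply, Pi.single_apply, eq_comm]
      · simp [hi, bipartiteMatrix]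
  · rw [if_congr (covered_inr_iff k l M j) rfl rfl]
    by_cases hj : j ∈ uncoveredRight M
    · rcases u with i' | j'
      · simp [hj, bipartiteMatrix, Fintype.sum_sum_type, Fintype.sum_prod_type, rootedBipartite,
          RootedGraph.vec, Pi.single_apply]
      · simp [hj, bipartiteMatrix, Fintype.sum_sum_type, Fintype.sum_prod_type, rootedBipartite,
          RootedGraph.vec, Matrix.diagonal_apply, Pi.single_apply]
        by_cases h : j' = j
        · simp [h]
        · simp [h, Ne.symm h]
    · rcases u with i' | j'
      · simp [hj, bipartiteMatrix]
      · simp [hj, bipartiteMatrix, Matrix.diagonal_apply, Pi.single_apply, eq_comm]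

open Classical in
theorem signedIndepSum_rootedBipartite :
    (-1 : ℝ) ^ (m + n) * (signedIndepSum (rootedBipartite m n k l).vec : ℝ) =
      ∑ M : Finset (Fin m × Fin n) with IsPartialMatching M,
        (bipartiteMatrix (uncoveredLeft M) (uncoveredRight M) ((n : ℝ) + k - 1)
          ((m : ℝ) + l - 1)).det := by
  have h := (rootedBipartite m n k l).signedIndepSum_vec_eq_sum_det
  rw [Fintype.card_sum, Fintype.card_fin, Fintype.card_fin] at h
  rw [h]
  symm
  refine sum_nbij (fun M => M.map Function.Embedding.inl) ?_ ?_ ?_ ?_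
  · intro M hM
    have hM := (mem_filter.1 hM).2
    refine mem_filter.2 ⟨mem_univ _, ?_, ?_⟩
    · simp [rootedBipartite]
    · simp only [mem_map, Function.Embedding.inl_apply]
      rintro _ ⟨e, he, rfl⟩ _ ⟨e', he', rfl⟩ v hv hv'
      by_contra hne
      have hne : e ≠ e' := fun h => hne (by rw [h])
      obtain ⟨h1, h2⟩ := hM e he e' he' hne
      rcases v with i | j
      · simp [RootedGraph.Inc, rootedBipartite] at hv hv'
        exact h1 (hv.trans hv'.symm)
      · simp [RootedGraph.Inc, rootedBipartite] at hv hv'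
        exact h2 (hv.trans hv'.symm)
  · exact (map_injective _).injOn
  · intro M hM
    obtain ⟨hroot, hdisj⟩ := (mem_filter.1 hM).2
    refine ⟨univ.filter fun e => Sum.inl e ∈ M, mem_filter.2 ⟨mem_univ _, ?_⟩, ?_⟩
    · intro e he e' he' hne
      have he := (mem_filter.1 he).2
      have he' := (mem_filter.1 he').2
      constructor
      · intro h
        refine hne (Sum.inl_injective (hdisj _ he _ he' (Sum.inl e.1) ?_ ?_))
        · exact Or.inl rfl
        · exact Or.inl (congrArg Sum.inl h.symm)
      · intro h
        refine hne (Sum.inl_injective (hdisj _ he _ he' (Sum.inr e.2) ?_ ?_))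
        · exact Or.inr rfl
        · exact Or.inr (congrArg (fun j => some (Sum.inr j)) h.symm)
    · ext e
      rcases e with e | e
      · simp
      · have : Sum.inr e ∉ M := fun h => hroot _ h rfl
        simp [this]
  · intro M _
    rw [shiftedLaplacian_rootedBipartite]

end RootedBipartite

/-! ### Counting partial matchings -/

section MatchingCount

variable {R : Type*} [CommRing R] {m n : ℕ}

/-- The sum of `φ |M|` over the partial matchings `M` of `K_{a,b}`. -/
def matchingCount (a b : ℕ) (φ : ℕ → R) : R :=
  ∑ i ∈ range (a + 1), (a.choose i : R) * (b.descFactorial i : R) * φ i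

/-- The extra vertex is either unmatched or matched to one of `b` vertices. For `b = 0` the
truncated `b - 1` has coefficient $0$. -/
theorem matchingCount_succ_left (a b : ℕ) (φ : ℕ → R) :
    matchingCount (a + 1) b φ =
      matchingCount a b φ + b * matchingCount a (b - 1) fun i => φ (i + 1) := by
  have h1 : matchingCount a b φ = ∑ i ∈ range (a + 1),
      (a.choose (i + 1) : R) * (b.descFactorial (i + 1) : R) * φ (i + 1) + φ 0 := by
    rw [matchingCount, sum_range_succ', sum_range_succ _ a]
    simp
  rw [h1, matchingCount, sum_range_succ', matchingCount, mul_sum, add_right_comm,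
    ← sum_add_distrib]
  congr 1
  · refine sum_congr rfl fun i _ => ?_
    have h2 : (b.descFactorial (i + 1) : R) = b * (b - 1).descFactorial i := by
      rcases b with _ | b
      · simp
      · rw [Nat.succ_descFactorial_succ]
        push_cast
        simp
    rw [Nat.choose_succ_succ, Nat.cast_add, h2]
    ring
  · simp

theorem matchingCount_comm (a b : ℕ) (φ : ℕ → R) : matchingCount a b φ = matchingCount b a φ := by
  have h : ∀ a b : ℕ, matchingCount a b φ = ∑ i ∈ range (a + b + 1),
      (a.choose i : R) * (b.choose i : R) * (i.factorial : R) * φ i := by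
    intro a b
    rw [matchingCount]
    refine Eq.trans (sum_subset (range_subset_range.2 (by omega)) fun i _ hi => ?_)
      (sum_congr rfl fun i _ => ?_)
    · rw [Nat.choose_eq_zero_of_lt (by simpa using hi)]
      simp
    · rw [Nat.descFactorial_eq_factorial_mul_choose]
      push_cast
      ring
  rw [h a b, h b a, add_comm a b]
  exact sum_congr rfl fun i _ => by ring

open Classical in
-- Induction on `P` by the recurrence for `matchingCount`: the new vertex is uncovered, or removing
-- its edge $(p,q)$ leaves a matching that avoids $p$ and $q$.
theorem sum_isPartialMatching_subset (P : Finset (Fin m)) : ∀ (Q : Finset (Fin n)) (φ : ℕ → R),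
    ∑ M ∈ (P ×ˢ Q).powerset.filter (fun M => IsPartialMatching M), φ M.card =
      matchingCount P.card Q.card φ := by
  induction P using Finset.induction_on with
  | empty =>
    intro Q φ
    simp [matchingCount, filter_singleton, IsPartialMatching]
  | insert p P hp ih =>
    intro Q φ
    rw [card_insert_of_notMem hp, matchingCount_succ_left, ← ih Q φ,
      ← sum_filter_add_sum_filter_not _ fun M => ∀ e ∈ M, e.1 ≠ p]
    congr 1
    · refine sum_congr ?_ fun _ _ => rfl
      ext M
      simp only [mem_filter, mem_powerset, subset_iff, mem_product, mem_insert]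
      constructor
      · rintro ⟨⟨h1, h2⟩, h3⟩
        exact ⟨fun e he => ⟨(h1 he).1.resolve_left (h3 e he), (h1 he).2⟩, h2⟩
      · rintro ⟨h1, h2⟩
        exact ⟨⟨fun e he => ⟨Or.inr (h1 he).1, (h1 he).2⟩, h2⟩,
          fun e he h => hp (h ▸ (h1 he).1)⟩
    · have h1 : ∀ q ∈ Q, ∑ M ∈ ((insert p P ×ˢ Q).powerset.filter
          (fun M => IsPartialMatching M)).filter (fun M => (p, q) ∈ M), φ M.card =
            matchingCount P.card (Q.card - 1) fun i => φ (i + 1) := by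
        intro q hq
        rw [← card_erase_of_mem hq, ← ih]
        refine sum_nbij' (fun M => M.erase (p, q)) (fun M => insert (p, q) M) ?_ ?_ ?_ ?_ ?_
        · intro M hM
          obtain ⟨hM, hpq⟩ := mem_filter.1 hM
          obtain ⟨hM, hpm⟩ := mem_filter.1 hM
          refine mem_filter.2 ⟨mem_powerset.2 fun e he => ?_, fun e he f hf =>
            hpm e (mem_of_mem_erase he) f (mem_of_mem_erase hf)⟩
          have h2 := mem_product.1 (mem_powerset.1 hM (mem_of_mem_erase he))
          have h3 := hpm e (mem_of_mem_erase he) _ hpq (ne_of_mem_erase he)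
          exact mem_product.2 ⟨(mem_insert.1 h2.1).resolve_left h3.1, mem_erase.2 ⟨h3.2, h2.2⟩⟩
        · intro M hM
          obtain ⟨hM, hpm⟩ := mem_filter.1 hM
          have h2 : ∀ e ∈ M, e.1 ≠ p ∧ e.2 ≠ q := fun e he => by
            have h3 := mem_product.1 (mem_powerset.1 hM he)
            exact ⟨fun h => hp (h ▸ h3.1), (mem_erase.1 h3.2).1⟩
          refine mem_filter.2 ⟨mem_filter.2 ⟨mem_powerset.2 ?_, ?_⟩, mem_insert_self _ _⟩
          · refine insert_subset (mem_product.2 ⟨mem_insert_self _ _, hq⟩) fun e he => ?_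
            have h3 := mem_product.1 (mem_powerset.1 hM he)
            exact mem_product.2 ⟨mem_insert_of_mem h3.1, mem_of_mem_erase h3.2⟩
          · intro e he f hf hne
            rcases mem_insert.1 he with rfl | he
            · rcases mem_insert.1 hf with rfl | hf
              · exact absurd rfl hne
              · exact ⟨(h2 f hf).1.symm, (h2 f hf).2.symm⟩
            · rcases mem_insert.1 hf with rfl | hf
              · exact h2 e he
              · exact hpm e he f hf hne
        · intro M hM
          exact insert_erase (mem_filter.1 hM).2
        · intro M hM
          refine erase_insert fun h => ?_
          have h3 := mem_product.1 (mem_powerset.1 (mem_filter.1 hM).1 h)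
          exact hp h3.1
        · intro M hM
          rw [card_erase_add_one (mem_filter.1 hM).2]
      -- A matching that covers `p` contains exactly one edge $(p,q)$, so the sum splits over `q`.
      have h2 : ∀ M ∈ ((insert p P ×ˢ Q).powerset.filter (fun M => IsPartialMatching M)).filter
          (fun M => ¬ ∀ e ∈ M, e.1 ≠ p), φ M.card =
            ∑ q ∈ Q, if (p, q) ∈ M then φ M.card else 0 := by
        intro M hM
        obtain ⟨hM, hcov⟩ := mem_filter.1 hM
        obtain ⟨hM, hpm⟩ := mem_filter.1 hM
        push Not at hcov
        obtain ⟨⟨p', q⟩, he, rfl⟩ := hcov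
        have hq := (mem_product.1 (mem_powerset.1 hM he)).2
        rw [sum_eq_single_of_mem q hq, if_pos he]
        intro q' _ hne
        exact if_neg fun he' => (hpm (p', q') he' (p', q) he fun h =>
          hne (congrArg Prod.snd h)).1 rfl
      rw [sum_congr rfl h2, sum_comm, ← nsmul_eq_mul, ← sum_const]
      refine sum_congr rfl fun q hq => ?_
      rw [← h1 q hq, ← sum_filter]
      refine sum_congr ?_ fun _ _ => rfl
      ext M
      rw [mem_filter, mem_filter, mem_filter (s := filter _ _)]
      exact ⟨fun h => ⟨h.1.1, h.2⟩, fun h => ⟨⟨h.1, fun h' => h' _ h.2 rfl⟩, h.2⟩⟩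

open Classical in
theorem sum_isPartialMatching (m n : ℕ) (φ : ℕ → R) :
    ∑ M : Finset (Fin m × Fin n) with IsPartialMatching M, φ M.card = matchingCount m n φ := by
  have h := sum_isPartialMatching_subset (univ : Finset (Fin m)) (univ : Finset (Fin n)) φ
  rw [card_univ, card_univ, Fintype.card_fin, Fintype.card_fin] at h
  rw [← h, univ_product_univ, powerset_univ]

theorem card_uncoveredLeft {M : Finset (Fin m × Fin n)} (hM : IsPartialMatching M) :
    (uncoveredLeft M).card = m - M.card := by
  have h : uncoveredLeft M = (M.image Prod.fst)ᶜ := by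
    ext i
    simp only [uncoveredLeft, mem_filter, mem_univ, true_and, mem_compl, mem_image]
    push Not
    rfl
  rw [h, card_compl, Fintype.card_fin, card_image_of_injOn]
  intro e he f hf hef
  by_contra hne
  exact (hM e he f hf hne).1 hef

theorem card_uncoveredRight {M : Finset (Fin m × Fin n)} (hM : IsPartialMatching M) :
    (uncoveredRight M).card = n - M.card := by
  have h : uncoveredRight M = (M.image Prod.snd)ᶜ := by
    ext i
    simp only [uncoveredRight, mem_filter, mem_univ, true_and, mem_compl, mem_image]
    push Not
    rfl
  rw [h, card_compl, Fintype.card_fin, card_image_of_injOn]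
  intro e he f hf hef
  by_contra hne
  exact (hM e he f hf hne).2 hef

theorem matchingSum_eq_matchingCount (m n : ℕ) (x y : R) :
    matchingSum m n x y = matchingCount m n fun i => x ^ (m - i) * y ^ (n - i) := by
  classical
  rw [← sum_isPartialMatching, matchingSum]
  refine sum_congr (by ext; simp) fun M hM => ?_
  have hM := (mem_filter.1 hM).2
  rw [← card_uncoveredLeft hM, ← card_uncoveredRight hM]
  simp only [uncoveredLeft, uncoveredRight]

theorem matchingSum_comm (m n : ℕ) (x y : R) : matchingSum m n x y = matchingSum n m y x := by
  rw [matchingSum_eq_matchingCount, matchingSum_eq_matchingCount, matchingCount_comm]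
  congr 1
  exact funext fun i => mul_comm _ _

theorem matchingSum_succ_left (m n : ℕ) (x y : R) :
    matchingSum (m + 1) n x y = x * matchingSum m n x y + n * matchingSum m (n - 1) x y := by
  simp only [matchingSum_eq_matchingCount]
  rw [matchingCount_succ_left]
  congr 1
  · rw [matchingCount, matchingCount, mul_sum]
    refine sum_congr rfl fun i hi => ?_
    have := mem_range.1 hi
    rw [show m + 1 - i = (m - i) + 1 by omega, pow_succ]
    ring
  · congr 2
    ext i
    rw [show m + 1 - (i + 1) = m - i by omega, show n - (i + 1) = n - 1 - i by omega]

theorem matchingSum_succ_right (m n : ℕ) (x y : R) :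
    matchingSum m (n + 1) x y = y * matchingSum m n x y + m * matchingSum (m - 1) n x y := by
  rw [matchingSum_comm, matchingSum_succ_left, matchingSum_comm n m, matchingSum_comm n (m - 1)]

/-- Double counting of matchings with a marked uncovered vertex in each part: pick the marked
vertices first, then a matching of the rest. The top summand vanishes, as it leaves no vertex of the
first part to mark. -/
theorem matchingCount_mul_mul (m n : ℕ) (x y : R) :
    (matchingCount (m + 1) (n + 1) fun i => ((m + 1 - i : ℕ) : R) * ((n + 1 - i : ℕ) : R) *
      x ^ (m + 1 - i - 1) * y ^ (n + 1 - i - 1)) =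
        (m + 1) * (n + 1) * matchingSum m n x y := by
  rw [matchingSum_eq_matchingCount, matchingCount, matchingCount, sum_range_succ, mul_sum]
  simp only [Nat.sub_self, Nat.cast_zero, zero_mul, mul_zero, add_zero]
  refine sum_congr rfl fun i _ => ?_
  have h1 : (((m + 1).choose i : ℕ) : R) * ((m + 1 - i : ℕ) : R) = (m + 1) * (m.choose i : R) := by
    rw [← Nat.cast_mul, ← Nat.choose_mul_succ_eq]
    push_cast
    ring
  have h2 : (((n + 1).descFactorial i : ℕ) : R) * ((n + 1 - i : ℕ) : R) =
      (n + 1) * (n.descFactorial i : R) := by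
    have := Nat.succ_descFactorial_succ n i
    rw [Nat.descFactorial_succ] at this
    rw [← Nat.cast_mul, mul_comm, this]
    push_cast
    ring
  rw [show m + 1 - i - 1 = m - i by omega, show n + 1 - i - 1 = n - i by omega]
  linear_combination (((n + 1).descFactorial i : ℕ) : R) * ((n + 1 - i : ℕ) : R) * x ^ (m - i) *
    y ^ (n - i) * h1 + (m + 1) * (m.choose i : R) * x ^ (m - i) * y ^ (n - i) * h2

theorem bipartiteHermite_natCast (m n : ℕ) (x y : R) :
    bipartiteHermite (m : ℤ) (n : ℤ) x y = matchingSum m n x y := by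
  simp [bipartiteHermite]

open Classical in
theorem sum_matching_sub (m n : ℕ) (x y : R) :
    ∑ M : Finset (Fin m × Fin n) with IsPartialMatching M,
      (x ^ (m - M.card) * y ^ (n - M.card) - ((m - M.card : ℕ) : R) * ((n - M.card : ℕ) : R) *
        x ^ (m - M.card - 1) * y ^ (n - M.card - 1)) =
      bipartiteHermite (m : ℤ) (n : ℤ) x y -
        m * n * bipartiteHermite ((m : ℤ) - 1) ((n : ℤ) - 1) x y := by
  rw [sum_sub_distrib, sum_isPartialMatching m n fun i => x ^ (m - i) * y ^ (n - i),
    sum_isPartialMatching m n fun i => ((m - i : ℕ) : R) * ((n - i : ℕ) : R) *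
        x ^ (m - i - 1) * y ^ (n - i - 1), ← matchingSum_eq_matchingCount,
    bipartiteHermite_natCast]
  congr 1
  rcases m with _ | m
  · simp [matchingCount]
  rcases n with _ | n
  · simp [matchingCount]
  · rw [matchingCount_mul_mul, ← bipartiteHermite_natCast]
    push_cast
    simp

end MatchingCount

/-! ### From all vertices to the non-root vertices -/

section Transfer

variable {U V E E' : Type*} [DecidableEq U] [DecidableEq V] [Fintype U] [Fintype E] [Fintype E']

/-- The embedding of `U → ℝ` onto the functions on all vertices with vanishing sum. -/
def zeroSumEmbedding (τ : Option U ≃ V) : (U → ℝ) →ₗ[ℝ] (V → ℝ) where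
  toFun w x := (τ.symm x).elim (-∑ u, w u) w
  map_add' w w' := by
    ext x
    rcases h : τ.symm x with _ | u
    · simp [h, sum_add_distrib, add_comm]
    · simp [h]
  map_smul' c w := by
    ext x
    rcases h : τ.symm x with _ | u
    · simp [h, mul_sum]
    · simp [h]

omit [DecidableEq U] [DecidableEq V] in
theorem zeroSumEmbedding_apply (τ : Option U ≃ V) (w : U → ℝ) (x : V) :
    zeroSumEmbedding τ w x = (τ.symm x).elim (-∑ u, w u) w := rfl

omit [DecidableEq U] [DecidableEq V] in
theorem zeroSumEmbedding_injective (τ : Option U ≃ V) :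
    Function.Injective (zeroSumEmbedding τ) := by
  intro w w' h
  ext u
  simpa [zeroSumEmbedding_apply] using congrFun h (τ (some u))

theorem zeroSumEmbedding_single (τ : Option U ≃ V) (u : U) :
    zeroSumEmbedding τ (Pi.single u 1) = Pi.single (τ (some u)) 1 - Pi.single (τ none) 1 := by
  ext x
  obtain ⟨o, rfl⟩ := τ.surjective x
  rcases o with _ | v
  · simp [zeroSumEmbedding_apply, Pi.single_apply]
  · simp [zeroSumEmbedding_apply, Pi.single_apply]

omit [Fintype E] in
theorem zeroSumEmbedding_vec (H : RootedGraph U E) (τ : Option U ≃ V) (e : E) :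
    zeroSumEmbedding τ (H.vec e) =
      Pi.single (τ (some (H.tail e))) 1 - Pi.single (τ (H.head e)) 1 := by
  rw [RootedGraph.vec, map_sub, zeroSumEmbedding_single]
  rcases H.head e with _ | u
  · simp
  · rw [Option.elim_some, zeroSumEmbedding_single]
    abel

/-- Edge vectors have coordinate sum $0$, so the root coordinate carries no information; reversing
an edge only changes a sign. -/
theorem signedIndepSum_edgeVector_eq_vec (H : RootedGraph U E) (τ : Option U ≃ V) (σ : E ≃ E')
    (G : DirectedMultigraph V E')
    (h : ∀ e, s(G.tail (σ e), G.head (σ e)) = s(τ (some (H.tail e)), τ (H.head e))) :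
    signedIndepSum G.edgeVector = signedIndepSum H.vec := by
  refine signedIndepSum_eq_of_equiv σ (zeroSumEmbedding τ) (zeroSumEmbedding_injective τ) _ _
    fun e => ?_
  rw [zeroSumEmbedding_vec, DirectedMultigraph.edgeVector]
  rcases Sym2.eq_iff.1 (h e) with ⟨h1, h2⟩ | ⟨h1, h2⟩
  · left; rw [h1, h2]
  · right; rw [h1, h2, neg_sub]

end Transfer

/-! ### Evaluation and the two formulas -/

section Main

variable (m n k l : ℕ)

theorem intCast_bipartiteHermite (a b x y : ℤ) :
    ((bipartiteHermite a b x y : ℤ) : ℝ) = bipartiteHermite a b (x : ℝ) (y : ℝ) := by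
  unfold bipartiteHermite
  split_ifs
  · simp [matchingSum]
  · simp

theorem neg_one_pow_mul_signedIndepSum_rootedBipartite :
    (-1) ^ (m + n) * signedIndepSum (rootedBipartite m n k l).vec =
      bipartiteHermite (m : ℤ) (n : ℤ) ((n : ℤ) + k - 1) ((m : ℤ) + l - 1) -
        (m : ℤ) * n * bipartiteHermite ((m : ℤ) - 1) ((n : ℤ) - 1)
          ((n : ℤ) + k - 1) ((m : ℤ) + l - 1) := by
  classical
  have h := signedIndepSum_rootedBipartite (m := m) (n := n) k l
  have h2 : ∀ M ∈ univ.filter (fun M : Finset (Fin m × Fin n) => IsPartialMatching M),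
      (bipartiteMatrix (uncoveredLeft M) (uncoveredRight M) ((n : ℝ) + k - 1)
        ((m : ℝ) + l - 1)).det =
      ((n : ℝ) + k - 1) ^ (m - M.card) * ((m : ℝ) + l - 1) ^ (n - M.card) -
        ((m - M.card : ℕ) : ℝ) * ((n - M.card : ℕ) : ℝ) *
        ((n : ℝ) + k - 1) ^ (m - M.card - 1) * ((m : ℝ) + l - 1) ^ (n - M.card - 1) := by
    intro M hM
    have hM := (mem_filter.1 hM).2
    rw [det_bipartiteMatrix, card_uncoveredLeft hM, card_uncoveredRight hM]
  have h3 : ((-1 : ℝ) ^ (m + n) * (signedIndepSum (rootedBipartite m n k l).vec : ℝ)) =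
      bipartiteHermite (m : ℤ) (n : ℤ) ((n : ℝ) + k - 1) ((m : ℝ) + l - 1) -
        m * n * bipartiteHermite ((m : ℤ) - 1) ((n : ℤ) - 1)
          ((n : ℝ) + k - 1) ((m : ℝ) + l - 1) := by
    rw [h, ← sum_matching_sub, ← sum_congr rfl h2]
  refine Int.cast_injective (α := ℝ) ?_
  push_cast [intCast_bipartiteHermite]
  exact h3

variable {m n k l}

/-- Connectedness gives the full rank $m+n$, which identifies the sign $(-1)^{m+n}$ in
`signedIndepSum_sign`. -/
theorem span_vec_rootedBipartite (hm : 1 ≤ m → 1 ≤ k ∨ (1 ≤ n ∧ 1 ≤ l))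
    (hn : 1 ≤ n → 1 ≤ l ∨ (1 ≤ m ∧ 1 ≤ k)) :
    Submodule.span ℝ (Set.range (rootedBipartite m n k l).vec) = ⊤ := by
  set S := Submodule.span ℝ (Set.range (rootedBipartite m n k l).vec) with hS
  have hmem : ∀ e, (rootedBipartite m n k l).vec e ∈ S := fun e =>
    Submodule.subset_span ⟨e, rfl⟩
  have hij : ∀ i j, (Pi.single (Sum.inl i) 1 - Pi.single (Sum.inr j) 1 :
      Fin m ⊕ Fin n → ℝ) ∈ S := fun i j => hmem (Sum.inl (i, j))
  have hik : ∀ (i : Fin m), 1 ≤ k → (Pi.single (Sum.inl i) 1 : Fin m ⊕ Fin n → ℝ) ∈ S :=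
    fun i hk => by
      simpa [RootedGraph.vec, rootedBipartite] using hmem (Sum.inr (Sum.inl (i, ⟨0, hk⟩)))
  have hjl : ∀ (j : Fin n), 1 ≤ l → (Pi.single (Sum.inr j) 1 : Fin m ⊕ Fin n → ℝ) ∈ S :=
    fun j hl => by
      simpa [RootedGraph.vec, rootedBipartite] using hmem (Sum.inr (Sum.inr (j, ⟨0, hl⟩)))
  rw [eq_top_iff, ← (Pi.basisFun ℝ (Fin m ⊕ Fin n)).span_eq, Submodule.span_le]
  rintro _ ⟨v, rfl⟩
  rw [Pi.basisFun_apply, SetLike.mem_coe]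
  rcases v with i | j
  · rcases hm (by have := i.pos; omega) with hk | ⟨hn', hl⟩
    · exact hik i hk
    · simpa using S.add_mem (hij i ⟨0, hn'⟩) (hjl ⟨0, hn'⟩ hl)
  · rcases hn (by have := j.pos; omega) with hl | ⟨hm', hk⟩
    · exact hjl j hl
    · simpa using S.sub_mem (hik ⟨0, hm'⟩ hk) (hij ⟨0, hm'⟩ j)

theorem mobiusCoinvariant_eq_of_rootedBipartite {V E : Type*} [DecidableEq V] [Fintype E]
    (hm : 1 ≤ m → 1 ≤ k ∨ (1 ≤ n ∧ 1 ≤ l)) (hn : 1 ≤ n → 1 ≤ l ∨ (1 ≤ m ∧ 1 ≤ k))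
    (G : DirectedMultigraph V E) (τ : Option (Fin m ⊕ Fin n) ≃ V)
    (σ : (Fin m × Fin n) ⊕ (Fin m × Fin k) ⊕ (Fin n × Fin l) ≃ E)
    (h : ∀ e, s(G.tail (σ e), G.head (σ e)) =
      s(τ (some ((rootedBipartite m n k l).tail e)), τ ((rootedBipartite m n k l).head e))) :
    (G.mobiusCoinvariant : ℤ) =
      bipartiteHermite (m : ℤ) (n : ℤ) ((n : ℤ) + k - 1) ((m : ℤ) + l - 1) -
        (m : ℤ) * n * bipartiteHermite ((m : ℤ) - 1) ((n : ℤ) - 1)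
          ((n : ℤ) + k - 1) ((m : ℤ) + l - 1) := by
  rw [G.mobiusCoinvariant_eq_natAbs, signedIndepSum_edgeVector_eq_vec _ τ σ G h,
    signedIndepSum_sign _ (span_vec_rootedBipartite hm hn), Module.finrank_fintype_fun_eq_card,
    Fintype.card_sum, Fintype.card_fin, Fintype.card_fin,
    neg_one_pow_mul_signedIndepSum_rootedBipartite]

/-- A vertex of the first part of `K_{m+1,n}` as the root. -/
def rootVertexEquiv (m n : ℕ) : Option (Fin m ⊕ Fin n) ≃ Fin (m + 1) ⊕ Fin n where
  toFun
    | none => Sum.inl 0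
    | some (Sum.inl i) => Sum.inl i.succ
    | some (Sum.inr j) => Sum.inr j
  invFun
    | Sum.inl i => Fin.cases none (fun i => some (Sum.inl i)) i
    | Sum.inr j => some (Sum.inr j)
  left_inv := by rintro (_ | i | j) <;> rfl
  right_inv := by
    rintro (i | j)
    · refine Fin.cases ?_ (fun i => ?_) i <;> rfl
    · rfl

/-- The edges of `K_{m+1,n}` as edges of a rooted bipartite graph. -/
def rootEdgeEquiv (m n : ℕ) :
    (Fin m × Fin n) ⊕ (Fin m × Fin 0) ⊕ (Fin n × Fin 1) ≃ Fin (m + 1) × Fin n where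
  toFun
    | Sum.inl e => (e.1.succ, e.2)
    | Sum.inr (Sum.inl e) => e.2.elim0
    | Sum.inr (Sum.inr e) => (0, e.1)
  invFun e := Fin.cases (Sum.inr (Sum.inr (e.2, 0))) (fun i => Sum.inl (i, e.2)) e.1
  left_inv := by
    rintro (e | e | ⟨j, c⟩)
    · rfl
    · exact e.2.elim0
    · rw [Subsingleton.elim c 0]; rfl
  right_inv := by
    rintro ⟨i, j⟩
    refine Fin.cases ?_ (fun i => ?_) i <;> rfl

/-- At $x=n$, $y=m$ the recurrence in the second index gives $m(H_{m,n}-nH_{m-1,n})$, and the one in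
the first index turns the bracket into $nH_{m-1,n-1}$. -/
theorem bipartiteHermite_sub_eq (m n : ℕ) :
    bipartiteHermite (m : ℤ) ((n + 1 : ℕ) : ℤ) (n : ℤ) (m : ℤ) -
      (m : ℤ) * ((n + 1 : ℕ) : ℤ) * bipartiteHermite ((m : ℤ) - 1) (((n + 1 : ℕ) : ℤ) - 1)
        (n : ℤ) (m : ℤ) =
      (m : ℤ) * n * bipartiteHermite ((m : ℤ) - 1) ((n : ℤ) - 1) (n : ℤ) (m : ℤ) := by
  rw [bipartiteHermite_natCast, matchingSum_succ_right]
  rcases m with _ | m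
  · simp
  have h1 : ((m + 1 : ℕ) : ℤ) - 1 = (m : ℕ) := by push_cast; ring
  have h2 : ((n + 1 : ℕ) : ℤ) - 1 = (n : ℕ) := by push_cast; ring
  rw [h1, h2, bipartiteHermite_natCast, matchingSum_succ_left, Nat.add_sub_cancel]
  rcases n with _ | n
  · simp
  have h3 : ((n + 1 : ℕ) : ℤ) - 1 = (n : ℕ) := by push_cast; ring
  rw [h3, bipartiteHermite_natCast, Nat.add_sub_cancel]
  push_cast
  ring

end Main

theorem theorem5p11 :
    (∀ (m n : ℕ), 1 ≤ m → 1 ≤ n →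
      ∀ G : DirectedMultigraph (Fin m ⊕ Fin n) (Fin m × Fin n),
        G.IsOrientationOf (completeBipartiteEnds m n) →
        (G.mobiusCoinvariant : ℤ) =
          ((m : ℤ) - 1) * ((n : ℤ) - 1) *
            bipartiteHermite ((m : ℤ) - 2) ((n : ℤ) - 2) ((n : ℤ) - 1) ((m : ℤ) - 1)) ∧
    (∀ (m n k l : ℕ),
      (1 ≤ m → 1 ≤ k ∨ (1 ≤ n ∧ 1 ≤ l)) → (1 ≤ n → 1 ≤ l ∨ (1 ≤ m ∧ 1 ≤ k)) →
      ∀ G : DirectedMultigraph (Option (Fin m ⊕ Fin n))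
          ((Fin m × Fin n) ⊕ (Fin m × Fin k) ⊕ (Fin n × Fin l)),
        G.IsOrientationOf (rootedBipartiteEnds m n k l) →
        (G.mobiusCoinvariant : ℤ) =
          bipartiteHermite (m : ℤ) (n : ℤ) ((n : ℤ) + k - 1) ((m : ℤ) + l - 1) -
            (m : ℤ) * n *
              bipartiteHermite ((m : ℤ) - 1) ((n : ℤ) - 1)
                ((n : ℤ) + k - 1) ((m : ℤ) + l - 1)) := by
  constructor
  · intro m n hm hn G hG
    obtain ⟨m, rfl⟩ : ∃ m', m = m' + 1 := ⟨m - 1, by omega⟩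
    obtain ⟨n, rfl⟩ : ∃ n', n = n' + 1 := ⟨n - 1, by omega⟩
    -- With a vertex of the first part as root, the graph is $K_{m,n+1}^{(0,1)}$ in the shifted
    -- indices.
    have h := mobiusCoinvariant_eq_of_rootedBipartite (m := m) (n := n + 1) (k := 0) (l := 1)
      (fun _ => Or.inr ⟨hn, le_rfl⟩) (fun _ => Or.inl le_rfl) G (rootVertexEquiv m (n + 1))
      (rootEdgeEquiv m (n + 1)) (by
        rintro (e | e | e)
        · exact hG _
        · exact e.2.elim0
        · exact (hG _).trans Sym2.eq_swap)
    have hx : (((n + 1 : ℕ) : ℤ) + (0 : ℕ) - 1) = n := by push_cast; ring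
    have hy : ((m : ℤ) + (1 : ℕ) - 1) = m := by push_cast; ring
    rw [h, hx, hy, bipartiteHermite_sub_eq]
    congr 2 <;> push_cast <;> ring
  · intro m n k l hm hn G hG
    refine mobiusCoinvariant_eq_of_rootedBipartite hm hn G (Equiv.refl _) (Equiv.refl _) ?_
    rintro (e | e | e)
    · exact hG _
    · exact (hG _).trans Sym2.eq_swap
    · exact (hG _).trans Sym2.eq_swap
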